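/- Let $d\ge 3$ be an integer, write $\langle v\rangle=\sqrt{1+|v|^2}$ for $v\in\mathbb R^d$, and for $p\ge 1$, $k\in\mathbb R$ set $\|f\|_{L^p_k}=\left(\int_{\mathbb R^d}|f(v)|^p\langle v\rangle^k\,dv\right)^{1/p}$ and $\|f\|_1=\|f\|_{L^1_0}$. For $\gamma\in[-d,0)$ let $$c_\gamma[g](v)=-(d-1)(\gamma+d)\int_{\mathbb R^d}|v-w|^\gamma g(w)\,dw\quad(-d<\gamma<0),\qquad c_{-d}[g](v)=-(d-1)(d-2)|\mathbb S^{d-1}|\,g(v).$$ (1) Let $-d<\gamma<0$, let $q\ge 1$ satisfy $\frac{d}{d+2+\gamma}<q<\frac{d}{d+\gamma}$, and put $s=\frac{d-q(d+\gamma)}{2q}$. Then $s\in(0,1)$, and there is a constant $C_0>0$ depending only on $d,\gamma,q$ such that, for every measurable $\phi:\mathbb R^d\to\mathbb R$ with $\langle\cdot\rangle^{\gamma/2}\phi\in H^1(\mathbb R^d)$ and every $g\ge 0$ in $L^1(\mathbb R^d)\cap L^q_{q|\gamma|}(\mathbb R^d)$, the integral defining $c_\gamma[g](v)$ converges for almost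 every $v$, the function $\phi^2c_\gamma[g]$ is integrable, and for every $\varepsilon>0$ $$-\int_{\mathbb R^d}\phi^2c_\gamma[g]\,dv\le\varepsilon\int_{\mathbb R^d}\left|\nabla\left(\langle v\rangle^{\gamma/2}\phi(v)\right)\right|^2dv+C_0\left(\|g\|_1+\varepsilon^{-\frac{s}{1-s}}\|g\|_{L^q_{q|\gamma|}}^{\frac1{1-s}}\right)\int_{\mathbb R^d}\phi^2\langle v\rangle^\gamma\,dv,$$ where $\nabla$ is the weak gradient. (2) Let $\gamma=-d$ and $\frac d2<q<\infty$. Then there is a constant $C_0>0$ depending only on $d,q$ such that, for every measurable $\phi:\mathbb R^d\to\mathbb R$ with $\langle\cdot\rangle^{-d/2}\phi\in H^1(\mathbb R^d)$ and every $g\ge 0$ in $L^q_{qd}(\mathbb R^d)$, the function $\phi^2c_{-d}[g]$ is integrable, and for every $\varepsilon>0$ $$-\int_{\mathbb R^d}\phi^2c_{-d}[g]\,dv\le\varepsilon\int_{\mathbb R^d}\left|\nabla\left(\langle v\rangle^{-d/2}\phi(v)\right)\right|^2dv+C_0\,\varepsilon^{-\frac{d}{2q-d}}\|g\|_{L^q_{qd}}^{\frac{2q}{2q-d}}\int_{\mathbb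 R^d}\phi^2\langle v\rangle^{-d}\,dv.$$ -/

import Mathlib

open MeasureTheory
open scoped ContDiff

noncomputable section

namespace Landau

/-- The Japanese bracket `⟨v⟩ = √(1 + |v|²)`. -/
def bracket {d : ℕ} (v : EuclideanSpace ℝ (Fin d)) : ℝ :=
  Real.sqrt (1 + ‖v‖ ^ 2)

/-- Membership in the weighted Lebesgue space `L^p_k`:
`f` is measurable and `∫ |f|^p ⟨v⟩^k dv < ∞`. -/
def MemWeightedLp {d : ℕ} (p k : ℝ) (f : EuclideanSpace ℝ (Fin d) → ℝ) : Prop :=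
  AEStronglyMeasurable f volume ∧
    Integrable (fun v => |f v| ^ p * bracket v ^ k) volume

/-- The norm `‖f‖_{L^p_k} = (∫ |f|^p ⟨v⟩^k dv)^{1/p}`. -/
def weightedLpNorm {d : ℕ} (p k : ℝ) (f : EuclideanSpace ℝ (Fin d) → ℝ) : ℝ :=
  (∫ v, |f v| ^ p * bracket v ^ k) ^ (1 / p)

/-- The surface measure `|𝕊^{d-1}|` of the unit sphere of `ℝ^d`. -/
def sphereArea (d : ℕ) : ℝ :=
  (volume : Measure (EuclideanSpace ℝ (Fin d))).toSphere.real Set.univ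

/-- The coefficient `c_γ[f]`, for `-d ≤ γ < 0`:
`c_γ[f](v) = -(d-1)(γ+d) ∫ |v-w|^γ f(w) dw` if `γ > -d`, and
`c_{-d}[f] = -(d-1)(d-2)|𝕊^{d-1}| f` in the Coulomb case. -/
def cCoeff {d : ℕ} (γ : ℝ) (f : EuclideanSpace ℝ (Fin d) → ℝ)
    (v : EuclideanSpace ℝ (Fin d)) : ℝ :=
  if γ = -(d : ℝ) then
    -(((d : ℝ) - 1) * ((d : ℝ) - 2) * sphereArea d) * f v
  else
    -(((d : ℝ) - 1) * (γ + d)) * ∫ w, ‖v - w‖ ^ γ * f w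

/-- `G` is the weak (distributional) gradient of `u` on `ℝ^d`. -/
structure HasWeakGradient {d : ℕ} (u : EuclideanSpace ℝ (Fin d) → ℝ)
    (G : EuclideanSpace ℝ (Fin d) → EuclideanSpace ℝ (Fin d)) : Prop where
  locallyIntegrable_fun : LocallyIntegrable u volume
  locallyIntegrable_grad : LocallyIntegrable G volume
  integral_eq : ∀ η : EuclideanSpace ℝ (Fin d) → ℝ, ContDiff ℝ ∞ η → HasCompactSupport η →
    ∀ i : Fin d,
      ∫ v, u v * fderiv ℝ η v (EuclideanSpace.single i 1) = -∫ v, G v i * η v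

/-- `u ∈ H¹(ℝ^d)`, with weak gradient `G`. -/
def IsH1WithGradient {d : ℕ} (u : EuclideanSpace ℝ (Fin d) → ℝ)
    (G : EuclideanSpace ℝ (Fin d) → EuclideanSpace ℝ (Fin d)) : Prop :=
  MemLp u 2 volume ∧ MemLp G 2 volume ∧ HasWeakGradient u G

end Landau

end

/-!
The function `u = ⟨v⟩^(γ/2) φ` lies in `H¹`, so by the Gagliardo–Nirenberg–Sobolev inequality
`u²` is in every `L^r` between `L¹` and `L^(d/(d-2))`, with a norm interpolating between `‖u‖₂²`
and `‖∇u‖₂²`.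

For `γ > -d`, either `|v - w| ≥ ⟨v⟩/2` or `⟨v⟩ ≤ 2⟨w⟩`, whence
`⟨v⟩^(-γ) |v - w|^γ ≤ 2^(-γ) (1 + |v - w|^γ ⟨w⟩^(-γ))`. The first term contributes `‖g‖₁ ‖u‖₂²`.
The second is the form `∫∫ u(v)² |v - w|^γ ⟨w⟩^(-γ) g(w)`. The kernel is cut at radius `R`, each
piece is estimated by Young's convolution inequality, with exponents on either side of the critical
one, and `R` is optimised: no Hardy–Littlewood–Sobolev inequality is needed, and the endpoint
`q = 1` is included. The result is a bound by `‖⟨·⟩^(-γ) g‖_q ‖u‖₂^(2(1-s)) ‖∇u‖₂^(2s)`. For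
`γ = -d` Hölder's inequality gives the same bound directly. Young's inequality for products then
splits off `ε ‖∇u‖₂²`.
-/

noncomputable section

namespace Landau

open Filter Topology ENNReal NNReal

theorem rpow_mul_rpow_mul_rpow_of_pairs (a b c : ℝ≥0∞) {r s t : ℝ} (hr : 0 ≤ r) (hs : 0 ≤ s)
    (ht : 0 ≤ t) :
    a ^ (r + s) * b ^ (r + t) * c ^ (s + t) = (a * b) ^ r * (a * c) ^ s * (b * c) ^ t := by
  simp only [ENNReal.mul_rpow_of_nonneg _ _ hr, ENNReal.mul_rpow_of_nonneg _ _ hs,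
    ENNReal.mul_rpow_of_nonneg _ _ ht, ENNReal.rpow_add_of_nonneg _ _ hr hs,
    ENNReal.rpow_add_of_nonneg _ _ hr ht, ENNReal.rpow_add_of_nonneg _ _ hs ht]
  ring

section Holder

variable {α : Type*} [MeasurableSpace α] {μ : Measure α}

theorem eLpNorm'_le_interpolation {F : α → ℝ≥0∞} (hF : AEMeasurable F μ) {p p₀ p₁ θ : ℝ}
    (hp : 0 < p) (hp₀ : 0 < p₀) (hp₁ : 0 < p₁) (hθ₀ : 0 ≤ θ) (hθ₁ : θ ≤ 1)
    (h : p⁻¹ = (1 - θ) * p₀⁻¹ + θ * p₁⁻¹) :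
    eLpNorm' F p μ ≤ eLpNorm' F p₀ μ ^ (1 - θ) * eLpNorm' F p₁ μ ^ θ := by
  have : 0 ≤ 1 - θ := sub_nonneg.2 hθ₁
  have ha : 0 ≤ p * ((1 - θ) * p₀⁻¹) := by positivity
  have hb : 0 ≤ p * (θ * p₁⁻¹) := by positivity
  have hab : p * ((1 - θ) * p₀⁻¹) + p * (θ * p₁⁻¹) = 1 := by
    rw [← mul_add, ← h, mul_inv_cancel₀ hp.ne']
  have hsplit (x : α) :
      (F x ^ p₀) ^ (p * ((1 - θ) * p₀⁻¹)) * (F x ^ p₁) ^ (p * (θ * p₁⁻¹)) = F x ^ p := by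
    rw [← ENNReal.rpow_mul, ← ENNReal.rpow_mul,
      ← ENNReal.rpow_add_of_nonneg _ _ (by positivity) (by positivity)]
    congr 1
    field_simp
    ring
  have hölder := ENNReal.lintegral_mul_norm_pow_le (hF.pow_const p₀) (hF.pow_const p₁) ha hb hab
  simp only [hsplit] at hölder
  simp only [eLpNorm'_eq_lintegral_enorm, enorm_eq_self, ← ENNReal.rpow_mul]
  refine (ENNReal.rpow_le_rpow hölder (by positivity)).trans_eq ?_
  rw [ENNReal.mul_rpow_of_nonneg _ _ (by positivity), ← ENNReal.rpow_mul, ← ENNReal.rpow_mul]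
  congr 2 <;> field_simp

theorem lintegral_rpow_mul_rpow_mul_rpow_le {f g k : α → ℝ≥0∞} (hf : AEMeasurable f μ)
    (hk : AEMeasurable k μ) (hg : AEMeasurable g μ) {r s t : ℝ} (hr : 0 ≤ r) (hs : 0 ≤ s)
    (ht : 0 ≤ t) (hsum : r + s + t = 1) :
    ∫⁻ z, f z ^ (r + s) * k z ^ (r + t) * g z ^ (s + t) ∂μ ≤
      (∫⁻ z, f z * k z ∂μ) ^ r * (∫⁻ z, f z * g z ∂μ) ^ s * (∫⁻ z, k z * g z ∂μ) ^ t := by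
  have hölder := ENNReal.lintegral_prod_norm_pow_le (Finset.univ : Finset (Fin 3))
    (f := ![fun z => f z * k z, fun z => f z * g z, fun z => k z * g z]) (p := ![r, s, t])
    (by intro i _; fin_cases i; exacts [hf.mul hk, hf.mul hg, hk.mul hg])
    (by simpa [Fin.sum_univ_three] using hsum)
    (by intro i _; fin_cases i <;> simpa)
  simp only [Fin.prod_univ_three, Matrix.cons_val_zero, Matrix.cons_val_one,
    Matrix.cons_val] at hölder
  simpa only [rpow_mul_rpow_mul_rpow_of_pairs _ _ _ hr hs ht] using hölder

theorem lintegral_mul_rpow_le {ρ f : α → ℝ≥0∞} (hρ : AEMeasurable ρ μ) (hf : AEMeasurable f μ)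
    {p : ℝ} (hp : 1 ≤ p) :
    (∫⁻ x, ρ x * f x ∂μ) ^ p ≤ (∫⁻ x, ρ x ∂μ) ^ (p - 1) * ∫⁻ x, ρ x * f x ^ p ∂μ := by
  have hp₀ : 0 < p := by linarith
  have ha : 0 ≤ 1 - p⁻¹ := sub_nonneg.2 (inv_le_one_of_one_le₀ hp)
  have hsplit (x : α) : ρ x ^ (1 - p⁻¹) * (ρ x * f x ^ p) ^ p⁻¹ = ρ x * f x := by
    rw [ENNReal.mul_rpow_of_nonneg _ _ (by positivity), ENNReal.rpow_rpow_inv hp₀.ne', ← mul_assoc,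
      ← ENNReal.rpow_add_of_nonneg _ _ ha (by positivity), sub_add_cancel, ENNReal.rpow_one]
  have hölder := ENNReal.lintegral_mul_norm_pow_le hρ (hρ.mul (hf.pow_const p)) ha
    (inv_nonneg.2 hp₀.le) (sub_add_cancel 1 p⁻¹)
  simp only [Pi.mul_apply, hsplit] at hölder
  refine (ENNReal.rpow_le_rpow hölder hp₀.le).trans_eq ?_
  rw [ENNReal.mul_rpow_of_nonneg _ _ hp₀.le, ENNReal.rpow_inv_rpow hp₀.ne', ← ENNReal.rpow_mul,
    sub_mul, inv_mul_cancel₀ hp₀.ne', one_mul]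

end Holder

section Convolution

variable {A : Type*} [AddCommGroup A] [MeasurableSpace A] {μ : Measure A}

/-- The trilinear form `∬ F(x) K(x - y) h(y) dy dx` of a convolution kernel `K`. -/
def convForm (F K h : A → ℝ≥0∞) (μ : Measure A) : ℝ≥0∞ :=
  ∫⁻ x, ∫⁻ y, F x * K (x - y) * h y ∂μ ∂μ

variable [MeasurableAdd₂ A] [μ.IsAddLeftInvariant]

theorem aemeasurable_comp_sub_const {K : A → ℝ≥0∞} (hK : AEMeasurable K μ) (y : A) :
    AEMeasurable (fun x => K (x - y)) μ :=
  hK.comp_quasiMeasurePreserving (measurePreserving_sub_right μ y).quasiMeasurePreserving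

variable [MeasurableNeg A] [SFinite μ]

theorem aemeasurable_comp_sub {K : A → ℝ≥0∞} (hK : AEMeasurable K μ) :
    AEMeasurable (fun z : A × A => K (z.1 - z.2)) (μ.prod μ) :=
  hK.comp_quasiMeasurePreserving (quasiMeasurePreserving_sub μ μ)

theorem aemeasurable_comp_const_sub {K : A → ℝ≥0∞} (hK : AEMeasurable K μ) (x : A) :
    AEMeasurable (fun y => K (x - y)) μ :=
  hK.comp_quasiMeasurePreserving (quasiMeasurePreserving_sub_left μ x)

theorem lintegral_prod_mul_comp_sub {f k : A → ℝ≥0∞} (hf : AEMeasurable f μ)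
    (hk : AEMeasurable k μ) [μ.IsNegInvariant] :
    ∫⁻ z, f z.1 * k (z.1 - z.2) ∂μ.prod μ = (∫⁻ x, f x ∂μ) * ∫⁻ x, k x ∂μ := by
  rw [lintegral_prod (fun z : A × A => f z.1 * k (z.1 - z.2))
    (hf.comp_fst.mul (aemeasurable_comp_sub hk)), ← lintegral_mul_const'' _ hf]
  refine lintegral_congr fun x => ?_
  simp only [lintegral_const_mul'' _ (aemeasurable_comp_const_sub hk x),
    lintegral_sub_left_eq_self k x]

theorem lintegral_prod_comp_sub_mul {k g : A → ℝ≥0∞} (hk : AEMeasurable k μ)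
    (hg : AEMeasurable g μ) :
    ∫⁻ z, k (z.1 - z.2) * g z.2 ∂μ.prod μ = (∫⁻ x, k x ∂μ) * ∫⁻ x, g x ∂μ := by
  rw [lintegral_prod_symm (fun z : A × A => k (z.1 - z.2) * g z.2)
    ((aemeasurable_comp_sub hk).mul hg.comp_snd), ← lintegral_const_mul'' _ hg]
  refine lintegral_congr fun y => ?_
  simp only [lintegral_mul_const'' _ (aemeasurable_comp_sub_const hk y),
    lintegral_sub_right_eq_self k y]

theorem lintegral_rpow_lintegral_mul_comp_sub_le {ρ N : A → ℝ≥0∞} (hρ : AEMeasurable ρ μ)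
    (hN : AEMeasurable N μ) {p : ℝ} (hp : 1 ≤ p) :
    ∫⁻ x, (∫⁻ y, ρ y * N (x - y) ∂μ) ^ p ∂μ ≤ (∫⁻ y, ρ y ∂μ) ^ p * ∫⁻ x, N x ^ p ∂μ := by
  have hNp := hN.pow_const p
  have hmeas : AEMeasurable (fun z : A × A => N (z.1 - z.2) ^ p * ρ z.2) (μ.prod μ) :=
    (aemeasurable_comp_sub hNp).mul hρ.comp_snd
  calc ∫⁻ x, (∫⁻ y, ρ y * N (x - y) ∂μ) ^ p ∂μ
      ≤ ∫⁻ x, (∫⁻ y, ρ y ∂μ) ^ (p - 1) * ∫⁻ y, N (x - y) ^ p * ρ y ∂μ ∂μ := by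
        refine lintegral_mono fun x => ?_
        simpa only [mul_comm (ρ _) (_ ^ p)] using
          lintegral_mul_rpow_le hρ (aemeasurable_comp_const_sub hN x) hp
    _ = (∫⁻ y, ρ y ∂μ) ^ (p - 1) * ((∫⁻ x, N x ^ p ∂μ) * ∫⁻ y, ρ y ∂μ) := by
        rw [lintegral_const_mul'' _ hmeas.lintegral_prod_right',
          ← lintegral_prod_comp_sub_mul hNp hρ, lintegral_prod _ hmeas]
    _ = (∫⁻ y, ρ y ∂μ) ^ p * ∫⁻ x, N x ^ p ∂μ := by
        conv_rhs => rw [← sub_add_cancel p 1,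
          ENNReal.rpow_add_of_nonneg _ _ (by linarith) zero_le_one, ENNReal.rpow_one,
          sub_add_cancel]
        ring

theorem eLpNorm_convolution_lsmul_le {F : Type*} [NormedAddCommGroup F] [NormedSpace ℝ F]
    {ρ : A → ℝ} {u : A → F} (hρ : AEStronglyMeasurable ρ μ) (hu : AEStronglyMeasurable u μ)
    {p : ℝ≥0∞} (hp : 1 ≤ p) (hp' : p ≠ ⊤) :
    eLpNorm (convolution ρ u (ContinuousLinearMap.lsmul ℝ ℝ) μ) p μ ≤
      eLpNorm ρ 1 μ * eLpNorm u p μ := by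
  have hp₀ : p ≠ 0 := (zero_lt_one.trans_le hp).ne'
  have hp₁ : 1 ≤ p.toReal := by simpa using ENNReal.toReal_mono hp' hp
  rw [eLpNorm_eq_lintegral_rpow_enorm_toReal hp₀ hp',
    eLpNorm_eq_lintegral_rpow_enorm_toReal hp₀ hp', eLpNorm_one_eq_lintegral_enorm]
  calc (∫⁻ x, ‖convolution ρ u (ContinuousLinearMap.lsmul ℝ ℝ) μ x‖ₑ ^ p.toReal ∂μ) ^ (1 / p.toReal)
      ≤ (∫⁻ x, (∫⁻ y, ‖ρ y‖ₑ * ‖u (x - y)‖ₑ ∂μ) ^ p.toReal ∂μ) ^ (1 / p.toReal) := by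
        gcongr with x
        refine (enorm_integral_le_lintegral_enorm _).trans_eq ?_
        simp only [ContinuousLinearMap.lsmul_apply, enorm_smul]
    _ ≤ ((∫⁻ y, ‖ρ y‖ₑ ∂μ) ^ p.toReal * ∫⁻ x, ‖u x‖ₑ ^ p.toReal ∂μ) ^ (1 / p.toReal) := by
        gcongr
        exact lintegral_rpow_lintegral_mul_comp_sub_le hρ.enorm hu.enorm hp₁
    _ = _ := by
        rw [ENNReal.mul_rpow_of_nonneg _ _ (by positivity), ← ENNReal.rpow_mul,
          mul_one_div_cancel (by positivity), ENNReal.rpow_one]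

theorem convForm_add {F K₁ K₂ h : A → ℝ≥0∞} (hF : AEMeasurable F μ) (hK₁ : AEMeasurable K₁ μ)
    (hh : AEMeasurable h μ) :
    convForm F (K₁ + K₂) h μ = convForm F K₁ h μ + convForm F K₂ h μ := by
  have hmeas : AEMeasurable (fun z : A × A => F z.1 * K₁ (z.1 - z.2) * h z.2) (μ.prod μ) :=
    (hF.comp_fst.mul (aemeasurable_comp_sub hK₁)).mul hh.comp_snd
  unfold convForm
  rw [← lintegral_add_left' hmeas.lintegral_prod_right']
  refine lintegral_congr fun x => ?_
  simp only [Pi.add_apply, mul_add, add_mul]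
  exact lintegral_add_left' (((aemeasurable_comp_const_sub hK₁ x).const_mul (F x)).mul hh) _

theorem convForm_le_eLpNorm' {F K h : A → ℝ≥0∞} (hF : AEMeasurable F μ) (hK : AEMeasurable K μ)
    (hh : AEMeasurable h μ) [μ.IsNegInvariant] {p r q : ℝ} (hp : 1 ≤ p) (hr : 1 ≤ r) (hq : 1 ≤ q)
    (hsum : p⁻¹ + r⁻¹ + q⁻¹ = 2) :
    convForm F K h μ ≤ eLpNorm' F p μ * eLpNorm' K r μ * eLpNorm' h q μ := by
  have hp' : 0 ≤ 1 - p⁻¹ := sub_nonneg.2 (inv_le_one_of_one_le₀ hp)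
  have hr' : 0 ≤ 1 - r⁻¹ := sub_nonneg.2 (inv_le_one_of_one_le₀ hr)
  have hq' : 0 ≤ 1 - q⁻¹ := sub_nonneg.2 (inv_le_one_of_one_le₀ hq)
  have hFm := hF.comp_fst (ν := μ)
  have hKm := aemeasurable_comp_sub hK
  have hhm := hh.comp_snd (μ := μ)
  have hölder := lintegral_rpow_mul_rpow_mul_rpow_le (hFm.pow_const p) (hKm.pow_const r)
    (hhm.pow_const q) hq' hr' hp' (by linarith)
  rw [lintegral_prod_mul_comp_sub (hF.pow_const p) (hK.pow_const r),
    lintegral_prod_comp_sub_mul (hK.pow_const r) (hh.pow_const q),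
    lintegral_prod_mul (hF.pow_const p) (hh.pow_const q),
    ← rpow_mul_rpow_mul_rpow_of_pairs _ _ _ hq' hr' hp',
    show 1 - q⁻¹ + (1 - r⁻¹) = p⁻¹ by linarith, show 1 - q⁻¹ + (1 - p⁻¹) = r⁻¹ by linarith,
    show 1 - r⁻¹ + (1 - p⁻¹) = q⁻¹ by linarith] at hölder
  simp only [ENNReal.rpow_rpow_inv (zero_lt_one.trans_le hp).ne',
    ENNReal.rpow_rpow_inv (zero_lt_one.trans_le hr).ne',
    ENNReal.rpow_rpow_inv (zero_lt_one.trans_le hq).ne'] at hölder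
  rw [lintegral_prod (fun z : A × A => F z.1 * K (z.1 - z.2) * h z.2)
    ((hFm.mul hKm).mul hhm)] at hölder
  simpa only [convForm, eLpNorm'_eq_lintegral_enorm, enorm_eq_self, one_div] using hölder

end Convolution

section Cutoff

variable {E F : Type*} [NormedAddCommGroup E] [NormedSpace ℝ E] [NormedAddCommGroup F]
  [NormedSpace ℝ F]

theorem norm_fderiv_comp_smul_smul_le {χ : E → ℝ} {u : E → F} (hχ : Differentiable ℝ χ)
    (hu : Differentiable ℝ u) (hχ₁ : ∀ x, ‖χ x‖ ≤ 1) {M : ℝ} (hM : ∀ x, ‖fderiv ℝ χ x‖ ≤ M)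
    {t : ℝ} (ht : 0 ≤ t) (x : E) :
    ‖fderiv ℝ (fun x => χ (t • x) • u x) x‖ ≤ ‖fderiv ℝ u x‖ + t * M * ‖u x‖ := by
  have hχt : HasFDerivAt (fun x => χ (t • x)) (t • fderiv ℝ χ (t • x)) x := by
    have hcomp : HasFDerivAt (fun x => χ (t • x)) _ x :=
      (hχ (t • x)).hasFDerivAt.comp x ((hasFDerivAt_id x).const_smul t)
    rwa [ContinuousLinearMap.comp_smul, ContinuousLinearMap.comp_id] at hcomp
  have hχu : fderiv ℝ (fun x => χ (t • x) • u x) x = _ := (hχt.smul (hu x).hasFDerivAt).fderiv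
  rw [hχu]
  refine (norm_add_le _ _).trans ?_
  rw [norm_smul, ContinuousLinearMap.norm_smulRight_apply, norm_smul, Real.norm_of_nonneg ht]
  gcongr
  · exact mul_le_of_le_one_left (norm_nonneg _) (hχ₁ _)
  · exact hM _

variable [MeasurableSpace E] [BorelSpace E] {μ : Measure E}

theorem eLpNorm_fderiv_comp_smul_smul_le [SecondCountableTopology E] {χ : E → ℝ} {u : E → F}
    (hχ : Differentiable ℝ χ) (hu : ContDiff ℝ 1 u) (hχ₁ : ∀ x, ‖χ x‖ ≤ 1) {M : ℝ}
    (hM : ∀ x, ‖fderiv ℝ χ x‖ ≤ M) {t : ℝ} (ht : 0 ≤ t) {p : ℝ≥0∞} (hp : 1 ≤ p) :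
    eLpNorm (fderiv ℝ fun x => χ (t • x) • u x) p μ ≤
      eLpNorm (fderiv ℝ u) p μ + ENNReal.ofReal (t * M) * eLpNorm u p μ := by
  have hM₀ : 0 ≤ M := (norm_nonneg _).trans (hM 0)
  calc eLpNorm (fderiv ℝ fun x => χ (t • x) • u x) p μ
      ≤ eLpNorm ((fun x => ‖fderiv ℝ u x‖) + (t * M) • fun x => ‖u x‖) p μ :=
        eLpNorm_mono_real
          (norm_fderiv_comp_smul_smul_le hχ (hu.differentiable one_ne_zero) hχ₁ hM ht)
    _ ≤ eLpNorm (fun x => ‖fderiv ℝ u x‖) p μ + eLpNorm ((t * M) • fun x => ‖u x‖) p μ :=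
        eLpNorm_add_le (hu.continuous_fderiv one_ne_zero).norm.aestronglyMeasurable
          (hu.continuous.norm.aestronglyMeasurable.const_smul _) hp
    _ = eLpNorm (fderiv ℝ u) p μ + ENNReal.ofReal (t * M) * eLpNorm u p μ := by
        rw [eLpNorm_const_smul, eLpNorm_norm, eLpNorm_norm,
          Real.enorm_of_nonneg (mul_nonneg ht hM₀)]

variable [FiniteDimensional ℝ E] [μ.IsAddHaarMeasure] {V : Type*} [NormedAddCommGroup V]
  [InnerProductSpace ℝ V] {p p' : ℝ≥0}

theorem eLpNorm_comp_smul_smul_le (hE : 0 < Module.finrank ℝ E) (hp : 1 ≤ p)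
    (hp' : (p' : ℝ)⁻¹ = (p : ℝ)⁻¹ - (Module.finrank ℝ E : ℝ)⁻¹) {χ : E → ℝ} {u : E → V}
    (hχ : ContDiff ℝ 1 χ) (hχc : HasCompactSupport χ) (hu : ContDiff ℝ 1 u)
    (hχ₁ : ∀ x, ‖χ x‖ ≤ 1) {M : ℝ} (hM : ∀ x, ‖fderiv ℝ χ x‖ ≤ M) {t : ℝ} (ht : 0 < t) :
    eLpNorm (fun x => χ (t • x) • u x) p' μ ≤ eLpNormLESNormFDerivOfEqInnerConst μ p *
      (eLpNorm (fderiv ℝ u) p μ + ENNReal.ofReal (t * M) * eLpNorm u p μ) :=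
  (eLpNorm_le_eLpNorm_fderiv_of_eq_inner μ ((hχ.comp (contDiff_const_smul t)).smul hu)
    (hχc.comp_smul ht.ne').smul_right hp hE hp').trans <| mul_le_mul_right
      (eLpNorm_fderiv_comp_smul_smul_le (hχ.differentiable one_ne_zero) hu hχ₁ hM ht.le
        (by exact_mod_cast hp)) _

theorem eLpNorm_le_eLpNorm_fderiv_of_memLp (hE : 0 < Module.finrank ℝ E) (hp : 1 ≤ p)
    (hp' : (p' : ℝ)⁻¹ = (p : ℝ)⁻¹ - (Module.finrank ℝ E : ℝ)⁻¹) {u : E → V}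
    (hu : ContDiff ℝ 1 u) (hup : MemLp u p μ) :
    eLpNorm u p' μ ≤
      eLpNormLESNormFDerivOfEqInnerConst μ p * eLpNorm (fderiv ℝ u) p μ := by
  let χ : ContDiffBump (0 : E) := ⟨1, 2, one_pos, one_lt_two⟩
  have hχ : ContDiff ℝ 1 χ := χ.contDiff
  obtain ⟨M, hM⟩ := (hχ.continuous_fderiv one_ne_zero).bounded_above_of_compact_support
    (χ.hasCompactSupport.fderiv ℝ)
  let t (n : ℕ) : ℝ := 1 / ((n : ℝ) + 1)
  have ht_lim : Tendsto t atTop (𝓝 0) := tendsto_one_div_add_atTop_nhds_zero_nat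
  let f (n : ℕ) (x : E) : V := χ (t n • x) • u x
  have hf_lim (x : E) : Tendsto (fun n => f n x) atTop (𝓝 (u x)) := by
    have hχ_lim : Tendsto (fun n => χ (t n • x)) atTop (𝓝 (χ 0)) :=
      (χ.continuous.tendsto 0).comp (by simpa using ht_lim.smul_const x)
    have hχ_zero : χ (0 : E) = 1 := χ.one_of_mem_closedBall (by simp [χ])
    simpa [f, hχ_zero] using hχ_lim.smul_const (u x)
  have hbound (n : ℕ) : eLpNorm (f n) p' μ ≤ eLpNormLESNormFDerivOfEqInnerConst μ p *
      (eLpNorm (fderiv ℝ u) p μ + ENNReal.ofReal (t n * M) * eLpNorm u p μ) :=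
    eLpNorm_comp_smul_smul_le hE hp hp' hχ χ.hasCompactSupport hu
      (fun x => by rw [Real.norm_of_nonneg χ.nonneg]; exact χ.le_one) hM Nat.one_div_pos_of_nat
  have hbound_lim : Tendsto (fun n => eLpNormLESNormFDerivOfEqInnerConst μ p *
      (eLpNorm (fderiv ℝ u) p μ + ENNReal.ofReal (t n * M) * eLpNorm u p μ)) atTop
      (𝓝 (eLpNormLESNormFDerivOfEqInnerConst μ p * eLpNorm (fderiv ℝ u) p μ)) := by
    have htM : Tendsto (fun n => ENNReal.ofReal (t n * M)) atTop (𝓝 0) := by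
      simpa using ENNReal.tendsto_ofReal (ht_lim.mul_const M)
    refine ENNReal.Tendsto.const_mul ?_ (Or.inr ENNReal.coe_ne_top)
    simpa using tendsto_const_nhds.add (ENNReal.Tendsto.mul_const htM (Or.inr hup.2.ne))
  have hf_meas (n : ℕ) : AEStronglyMeasurable (f n) μ :=
    ((χ.continuous.comp (continuous_const_smul (t n))).smul hu.continuous).aestronglyMeasurable
  calc eLpNorm u p' μ
      ≤ atTop.liminf fun n => eLpNorm (f n) p' μ :=
        Lp.eLpNorm_lim_le_liminf_eLpNorm hf_meas u (ae_of_all _ hf_lim)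
    _ ≤ atTop.liminf fun n => _ := liminf_le_liminf (Eventually.of_forall hbound)
    _ = _ := hbound_lim.liminf_eq

theorem eLpNorm_normed_convolution_le {F : Type*} [NormedAddCommGroup F] [NormedSpace ℝ F]
    (ψ : ContDiffBump (0 : E)) {u : E → F} (hu : AEStronglyMeasurable u μ) {p : ℝ≥0∞}
    (hp : 1 ≤ p) (hp' : p ≠ ⊤) :
    eLpNorm (convolution (ψ.normed μ) u (ContinuousLinearMap.lsmul ℝ ℝ) μ) p μ ≤
      eLpNorm u p μ := by
  have hψ : eLpNorm (ψ.normed μ) 1 μ = 1 := by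
    rw [eLpNorm_one_eq_lintegral_enorm,
      ← ofReal_integral_norm_eq_lintegral_enorm ψ.integrable_normed]
    simp [Real.norm_of_nonneg (ψ.nonneg_normed _), ψ.integral_normed]
  simpa [hψ] using
    eLpNorm_convolution_lsmul_le (ψ.continuous_normed (μ := μ)).aestronglyMeasurable hu hp hp'

end Cutoff

section Sobolev

variable {d : ℕ}

local notation "𝔼" => EuclideanSpace ℝ (Fin d)

theorem HasWeakGradient.fderiv_convolution {u : 𝔼 → ℝ} {G : 𝔼 → 𝔼} (h : HasWeakGradient u G)
    {ρ : 𝔼 → ℝ} (hρ : ContDiff ℝ ∞ ρ) (hρc : HasCompactSupport ρ) (x : 𝔼) :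
    fderiv ℝ (convolution ρ u (ContinuousLinearMap.lsmul ℝ ℝ) volume) x =
      innerSL ℝ (convolution ρ G (ContinuousLinearMap.lsmul ℝ ℝ) volume x) := by
  set η : 𝔼 → ℝ := fun t => ρ (x - t)
  have hη : ContDiff ℝ ∞ η := hρ.comp (contDiff_const.sub contDiff_id)
  have hηc : HasCompactSupport η := hρc.comp_homeomorph (Homeomorph.subLeft x)
  have hη_fderiv (t v : 𝔼) : fderiv ℝ η t v = -fderiv ℝ ρ (x - t) v := by
    have hη' : HasFDerivAt η _ t := (hρ.differentiable (by norm_num) (x - t)).hasFDerivAt.comp t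
      ((hasFDerivAt_id t).const_sub x)
    rw [hη'.fderiv]
    simp
  have hηG : Integrable (fun t => η t • G t) volume :=
    h.locallyIntegrable_grad.integrable_smul_left_of_hasCompactSupport hη.continuous hηc
  have hder := hρc.hasFDerivAt_convolution_right (ContinuousLinearMap.lsmul ℝ ℝ).flip
    h.locallyIntegrable_fun (hρ.of_le (by norm_num)) x
  rw [convolution_flip] at hder
  refine ContinuousLinearMap.coe_injective
    ((EuclideanSpace.basisFun (Fin d) ℝ).toBasis.ext fun i => ?_)
  simp only [OrthonormalBasis.coe_toBasis, EuclideanSpace.basisFun_apply,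
    ContinuousLinearMap.coe_coe, innerSL_apply_apply, EuclideanSpace.inner_single_right,
    conj_trivial, one_mul]
  calc fderiv ℝ (convolution ρ u (ContinuousLinearMap.lsmul ℝ ℝ) volume) x
        (EuclideanSpace.single i 1)
      = ∫ t, u t * fderiv ℝ ρ (x - t) (EuclideanSpace.single i 1) := by
        rw [hder.fderiv, convolution_precompR_apply _ h.locallyIntegrable_fun (hρc.fderiv ℝ)
          (hρ.continuous_fderiv (by norm_num)), convolution_def]
        simp [mul_comm]
    _ = ∫ t, G t i * η t := by
        simpa [hη_fderiv, integral_neg] using h.integral_eq η hη hηc i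
    _ = convolution ρ G (ContinuousLinearMap.lsmul ℝ ℝ) volume x i := by
        have hproj := (EuclideanSpace.proj (𝕜 := ℝ) i).integral_comp_comm hηG
        simp only [PiLp.proj_apply, PiLp.smul_apply, smul_eq_mul] at hproj
        simp only [convolution_eq_swap, ContinuousLinearMap.lsmul_apply, ← hproj, η, mul_comm]

theorem IsH1WithGradient.eLpNorm_le (hd : 0 < d) {p' : ℝ≥0} (hp' : (p' : ℝ)⁻¹ = 2⁻¹ - (d : ℝ)⁻¹)
    {u : 𝔼 → ℝ} {G : 𝔼 → 𝔼} (h : IsH1WithGradient u G) :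
    eLpNorm u p' volume ≤
      eLpNormLESNormFDerivOfEqInnerConst (volume : Measure 𝔼) 2 * eLpNorm G 2 volume := by
  obtain ⟨hu, hG, hw⟩ := h
  let r (n : ℕ) : ℝ := 1 / ((n : ℝ) + 1)
  have hr (n : ℕ) : 0 < r n := Nat.one_div_pos_of_nat
  let ψ (n : ℕ) : ContDiffBump (0 : 𝔼) := ⟨r n, 2 * r n, hr n, by linarith [hr n]⟩
  let f (n : ℕ) : 𝔼 → ℝ :=
    convolution ((ψ n).normed volume) u (ContinuousLinearMap.lsmul ℝ ℝ) volume
  have hf (n : ℕ) : ContDiff ℝ 1 (f n) :=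
    (ψ n).hasCompactSupport_normed.contDiff_convolution_left (n := 1)
      (ContinuousLinearMap.lsmul ℝ ℝ) (ψ n).contDiff_normed hw.locallyIntegrable_fun
  have hf_two (n : ℕ) : eLpNorm (f n) 2 volume ≤ eLpNorm u 2 volume :=
    eLpNorm_normed_convolution_le (ψ n) hu.1 one_le_two ofNat_ne_top
  have hf_fderiv (n : ℕ) : eLpNorm (fderiv ℝ (f n)) 2 volume ≤ eLpNorm G 2 volume := by
    refine (eLpNorm_congr_norm_ae (ae_of_all _ fun x => ?_)).trans_le
      (eLpNorm_normed_convolution_le (ψ n) hG.1 one_le_two ofNat_ne_top)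
    rw [hw.fderiv_convolution (ψ n).contDiff_normed (ψ n).hasCompactSupport_normed,
      innerSL_apply_norm]
  have hf_lim : ∀ᵐ x, Tendsto (fun n => f n x) atTop (𝓝 (u x)) :=
    ContDiffBump.ae_convolution_tendsto_right_of_locallyIntegrable (K := 2)
      (by simpa [ψ, r] using (tendsto_one_div_add_atTop_nhds_zero_nat (𝕜 := ℝ)).const_mul 2)
      (Eventually.of_forall fun n => le_rfl) hw.locallyIntegrable_fun
  refine Lp.eLpNorm_le_of_ae_tendsto (u := atTop) (Eventually.of_forall fun n => ?_)
    (fun n => (hf n).continuous.aestronglyMeasurable) hf_lim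
  refine (eLpNorm_le_eLpNorm_fderiv_of_memLp (by simpa using hd) one_le_two (by simpa using hp')
    (hf n) ⟨(hf n).continuous.aestronglyMeasurable, (hf_two n).trans_lt hu.2⟩).trans ?_
  exact mul_le_mul_right (hf_fderiv n) _

end Sobolev

section SobolevInterpolation

/-- The square of Mathlib's constant in the Sobolev inequality `H¹ ⊆ L^{2d/(d-2)}` on `ℝ^d`. -/
def sobolevConst (d : ℕ) : ℝ≥0 :=
  eLpNormLESNormFDerivOfEqInnerConst (volume : Measure (EuclideanSpace ℝ (Fin d))) 2 ^ 2

variable {d : ℕ} {u : EuclideanSpace ℝ (Fin d) → ℝ}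
  {G : EuclideanSpace ℝ (Fin d) → EuclideanSpace ℝ (Fin d)}

theorem eLpNorm_two_sq {F : Type*} [NormedAddCommGroup F] {α : Type*} [MeasurableSpace α]
    {μ : Measure α} (f : α → F) : eLpNorm f 2 μ ^ 2 = ∫⁻ x, ‖f x‖ₑ ^ 2 ∂μ := by
  simpa using eLpNorm_nnreal_pow_eq_lintegral (f := f) (p := 2) (μ := μ) two_ne_zero

theorem IsH1WithGradient.eLpNorm'_sq_le (hd : 3 ≤ d) (h : IsH1WithGradient u G) :
    eLpNorm' (fun v => ‖u v‖ₑ ^ 2) (1 - 2 / d)⁻¹ volume ≤ sobolevConst d * ∫⁻ v, ‖G v‖ₑ ^ 2 := by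
  have hd' : (3 : ℝ) ≤ d := by exact_mod_cast hd
  have hp : 0 < 1 - 2 / (d : ℝ) := by
    rw [sub_pos, div_lt_one (by linarith)]
    linarith
  obtain ⟨p', hp'⟩ : ∃ p' : ℝ≥0, (p' : ℝ) = (1 - 2 / (d : ℝ))⁻¹ * 2 :=
    ⟨⟨_, by positivity⟩, rfl⟩
  have hp'₀ : p' ≠ 0 := by
    rw [← NNReal.coe_ne_zero, hp']
    positivity
  have hp'_inv : (p' : ℝ)⁻¹ = 2⁻¹ - (d : ℝ)⁻¹ := by
    rw [hp', mul_inv, inv_inv]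
    ring
  have hsq := eLpNorm'_enorm_rpow (μ := volume) u (1 - 2 / (d : ℝ))⁻¹ 2 two_pos
  have hp'_eLpNorm : eLpNorm' u p' volume = eLpNorm u p' volume := by
    rw [eLpNorm_eq_eLpNorm' (by simpa using hp'₀) coe_ne_top, coe_toReal]
  simp only [ENNReal.rpow_ofNat] at hsq
  calc eLpNorm' (fun v => ‖u v‖ₑ ^ 2) (1 - 2 / d)⁻¹ volume = eLpNorm u p' volume ^ 2 := by
        rw [hsq, ← hp'_eLpNorm, hp']
    _ ≤ (eLpNormLESNormFDerivOfEqInnerConst volume 2 * eLpNorm G 2 volume) ^ 2 := by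
        gcongr
        exact h.eLpNorm_le (by omega) hp'_inv
    _ = sobolevConst d * ∫⁻ v, ‖G v‖ₑ ^ 2 := by
        rw [mul_pow, eLpNorm_two_sq, sobolevConst, ENNReal.coe_pow]

theorem IsH1WithGradient.eLpNorm'_sq_le_interpolation (hd : 3 ≤ d) (h : IsH1WithGradient u G)
    {p θ : ℝ} (hθ₀ : 0 ≤ θ) (hθ₁ : θ ≤ 1) (hp : p⁻¹ = 1 - 2 * θ / d) :
    eLpNorm' (fun v => ‖u v‖ₑ ^ 2) p volume ≤
      (∫⁻ v, ‖u v‖ₑ ^ 2) ^ (1 - θ) * (sobolevConst d * ∫⁻ v, ‖G v‖ₑ ^ 2) ^ θ := by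
  have hd' : (3 : ℝ) ≤ d := by exact_mod_cast hd
  have hp₀ : 0 < p := by
    rw [← inv_pos, hp, sub_pos, div_lt_one (by linarith)]
    linarith
  have hp₁ : 0 < 1 - 2 / (d : ℝ) := by
    rw [sub_pos, div_lt_one (by linarith)]
    linarith
  have hint := eLpNorm'_le_interpolation (h.1.1.enorm.pow_const 2) hp₀ zero_lt_one
    (inv_pos.2 hp₁) hθ₀ hθ₁ (by rw [hp, inv_inv]; ring)
  refine hint.trans ?_
  gcongr
  · simp [eLpNorm'_eq_lintegral_enorm]
  · exact h.eLpNorm'_sq_le hd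

end SobolevInterpolation

section NormPower

variable {E : Type*} [NormedAddCommGroup E] [NormedSpace ℝ E] [MeasurableSpace E] {μ : Measure E}

local notation "dim" => (Module.finrank ℝ E : ℝ)

theorem eLpNorm'_indicator_norm_rpow {s : Set E} (hs : MeasurableSet s) {γ r c R : ℝ} (hr : 0 < r)
    (hc : 0 ≤ c) (hR : 0 < R)
    (h : ∫⁻ x in s, ENNReal.ofReal (‖x‖ ^ (γ * r)) ∂μ = ENNReal.ofReal (c * R ^ (dim + γ * r))) :
    eLpNorm' (s.indicator fun x => ENNReal.ofReal (‖x‖ ^ γ)) r μ =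
      ENNReal.ofReal (c ^ (1 / r)) * ENNReal.ofReal (R ^ (γ + dim / r)) := by
  have hpow (x : E) : s.indicator (fun x => ENNReal.ofReal (‖x‖ ^ γ)) x ^ r =
      s.indicator (fun x => ENNReal.ofReal (‖x‖ ^ (γ * r))) x := by
    by_cases hx : x ∈ s
    · simp only [Set.indicator_of_mem hx]
      rw [ENNReal.ofReal_rpow_of_nonneg (by positivity) hr.le, Real.rpow_mul (norm_nonneg x)]
    · simp [Set.indicator_of_notMem hx, hr]
  simp only [eLpNorm'_eq_lintegral_enorm, enorm_eq_self, hpow]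
  rw [lintegral_indicator hs, h, ENNReal.ofReal_rpow_of_nonneg (by positivity) (by positivity),
    Real.mul_rpow hc (by positivity), ← Real.rpow_mul hR.le, ENNReal.ofReal_mul (by positivity)]
  congr 3
  field_simp
  ring

variable [FiniteDimensional ℝ E] [Nontrivial E] [BorelSpace E] [μ.IsAddHaarMeasure]

theorem setLIntegral_preimage_norm_rpow {I : Set ℝ} (hI : MeasurableSet I) {a : ℝ}
    (hint : IntegrableOn (fun r : ℝ => r ^ (dim + a - 1)) (Set.Ioi 0 ∩ I)) :
    ∫⁻ x in norm ⁻¹' I, ENNReal.ofReal (‖x‖ ^ a) ∂μ = ENNReal.ofReal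
      (dim * (μ.real (Metric.ball 0 1) * ∫ r in Set.Ioi 0 ∩ I, r ^ (dim + a - 1))) := by
  set f : ℝ → ℝ := I.indicator fun r => r ^ a with hf
  have hpolar : Set.EqOn (fun r => r ^ (Module.finrank ℝ E - 1) • f r)
      (I.indicator fun r => r ^ (dim + a - 1)) (Set.Ioi 0) := by
    intro r (hr : 0 < r)
    by_cases hrI : r ∈ I
    · simp only [hf, Set.indicator_of_mem hrI, smul_eq_mul]
      rw [← Real.rpow_natCast, ← Real.rpow_add hr, Nat.cast_pred Module.finrank_pos]
      ring_nf
    · simp [hf, Set.indicator_of_notMem hrI]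
  have hf_int : Integrable (fun x => f ‖x‖) μ := by
    rw [integrable_fun_norm_addHaar, integrableOn_congr_fun hpolar measurableSet_Ioi]
    exact (integrableOn_indicator_iff hI).2 (by rwa [Set.inter_comm])
  have hf_nonneg (x : E) : 0 ≤ f ‖x‖ :=
    Set.indicator_apply_nonneg fun _ => by positivity
  calc ∫⁻ x in norm ⁻¹' I, ENNReal.ofReal (‖x‖ ^ a) ∂μ = ∫⁻ x, ENNReal.ofReal (f ‖x‖) ∂μ := by
        rw [← lintegral_indicator (measurable_norm hI)]
        congr with x
        by_cases hx : ‖x‖ ∈ I <;> simp [hf, Set.indicator, hx]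
    _ = _ := by
        rw [← ofReal_integral_eq_lintegral_ofReal hf_int (.of_forall hf_nonneg),
          integral_fun_norm_addHaar, setIntegral_congr_fun measurableSet_Ioi hpolar,
          setIntegral_indicator hI, nsmul_eq_mul, smul_eq_mul]

theorem setLIntegral_ball_norm_rpow {a R : ℝ} (ha : 0 < dim + a) (hR : 0 < R) :
    ∫⁻ x in Metric.ball 0 R, ENNReal.ofReal (‖x‖ ^ a) ∂μ = ENNReal.ofReal
      (dim * μ.real (Metric.ball 0 1) / (dim + a) * R ^ (dim + a)) := by
  have hball : Metric.ball (0 : E) R = norm ⁻¹' Set.Iio R := by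
    ext
    simp
  have hint : IntegrableOn (fun r : ℝ => r ^ (dim + a - 1)) (Set.Ioo 0 R) :=
    (intervalIntegral.integrableOn_Ioo_rpow_iff hR).2 (by linarith)
  rw [hball, setLIntegral_preimage_norm_rpow measurableSet_Iio hint, Set.Ioi_inter_Iio,
    ← integral_Ioc_eq_integral_Ioo, ← intervalIntegral.integral_of_le hR.le,
    integral_rpow (.inl (by linarith)), sub_add_cancel, Real.zero_rpow ha.ne', sub_zero]
  congr 1
  ring

theorem setLIntegral_compl_ball_norm_rpow {a R : ℝ} (ha : dim + a < 0) (hR : 0 < R) :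
    ∫⁻ x in (Metric.ball 0 R)ᶜ, ENNReal.ofReal (‖x‖ ^ a) ∂μ = ENNReal.ofReal
      (dim * μ.real (Metric.ball 0 1) / -(dim + a) * R ^ (dim + a)) := by
  have hcompl : (Metric.ball (0 : E) R)ᶜ = norm ⁻¹' Set.Ici R := by
    ext
    simp
  have hIci : Set.Ioi 0 ∩ Set.Ici R = Set.Ici R :=
    Set.inter_eq_right.2 fun r (hr : R ≤ r) => hR.trans_le hr
  have hint : IntegrableOn (fun r : ℝ => r ^ (dim + a - 1)) (Set.Ioi 0 ∩ Set.Ici R) := by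
    rw [hIci, integrableOn_Ici_iff_integrableOn_Ioi]
    exact integrableOn_Ioi_rpow_of_lt (by linarith) hR
  rw [hcompl, setLIntegral_preimage_norm_rpow measurableSet_Ici hint, hIci,
    integral_Ici_eq_integral_Ioi, integral_Ioi_rpow_of_lt (by linarith) hR, sub_add_cancel]
  congr 1
  rw [div_neg]
  ring

end NormPower

section Riesz

theorem exists_scale_rpow_mul_interpolation_le {X Z : ℝ≥0∞} (hX : X ≠ ⊤) (hZ : Z ≠ ⊤)
    (s : ℝ) :
    ∃ R : ℝ, 0 < R ∧ ∀ θ ∈ Set.Ioo (0 : ℝ) 1,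
      ENNReal.ofReal (R ^ (2 * (θ - s))) * (X ^ (1 - θ) * Z ^ θ) ≤ X ^ (1 - s) * Z ^ s := by
  rcases eq_or_ne X 0 with rfl | hX₀
  · refine ⟨1, one_pos, fun θ hθ => ?_⟩
    simp [ENNReal.zero_rpow_of_pos (sub_pos.2 hθ.2)]
  rcases eq_or_ne Z 0 with rfl | hZ₀
  · refine ⟨1, one_pos, fun θ hθ => ?_⟩
    simp [ENNReal.zero_rpow_of_pos hθ.1]
  lift X to ℝ≥0 using hX
  lift Z to ℝ≥0 using hZ
  norm_cast at hX₀ hZ₀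
  have : (0 : ℝ) < X := by positivity
  have : (0 : ℝ) < Z := by positivity
  refine ⟨((X / Z) ^ (2⁻¹ : ℝ) : ℝ≥0), by positivity, fun θ _ => ?_⟩
  simp only [← NNReal.coe_rpow, ENNReal.ofReal_coe_nnreal]
  simp only [← ENNReal.coe_rpow_of_ne_zero hX₀, ← ENNReal.coe_rpow_of_ne_zero hZ₀]
  norm_cast
  apply le_of_eq
  calc ((X / Z) ^ (2⁻¹ : ℝ)) ^ (2 * (θ - s)) * (X ^ (1 - θ) * Z ^ θ)
      = (X / Z) ^ (θ - s) * (X ^ (1 - θ) * Z ^ θ) := by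
        rw [← NNReal.rpow_mul, inv_mul_cancel_left₀ two_ne_zero]
    _ = X ^ (θ - s) * X ^ (1 - θ) * (Z ^ θ / Z ^ (θ - s)) := by
        rw [NNReal.div_rpow]
        ring
    _ = X ^ (1 - s) * Z ^ s := by
        rw [← NNReal.rpow_add hX₀, ← NNReal.rpow_sub hZ₀]
        ring_nf

variable {d : ℕ} {u : EuclideanSpace ℝ (Fin d) → ℝ}
  {G : EuclideanSpace ℝ (Fin d) → EuclideanSpace ℝ (Fin d)}
  {h : EuclideanSpace ℝ (Fin d) → ℝ≥0∞}

theorem IsH1WithGradient.convForm_sq_le (hd : 3 ≤ d) (hu : IsH1WithGradient u G)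
    {K : EuclideanSpace ℝ (Fin d) → ℝ≥0∞} (hK : AEMeasurable K volume)
    (hh : AEMeasurable h volume) {q r θ : ℝ} (hq : 1 ≤ q) (hr : 1 ≤ r) (hθ₀ : 0 ≤ θ) (hθ₁ : θ ≤ 1)
    (hrθ : r⁻¹ = 1 - q⁻¹ + 2 * θ / d) :
    convForm (fun v => ‖u v‖ₑ ^ 2) K h volume ≤ eLpNorm' K r volume * eLpNorm' h q volume *
      ((∫⁻ v, ‖u v‖ₑ ^ 2) ^ (1 - θ) * (sobolevConst d * ∫⁻ v, ‖G v‖ₑ ^ 2) ^ θ) := by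
  have hd' : (3 : ℝ) ≤ d := by exact_mod_cast hd
  have hp : 0 < 1 - 2 * θ / d := by
    rw [sub_pos, div_lt_one (by linarith)]
    linarith
  have hp₁ : 1 ≤ (1 - 2 * θ / d)⁻¹ := by
    rw [one_le_inv₀ hp]
    linarith [show 0 ≤ 2 * θ / d by positivity]
  calc convForm (fun v => ‖u v‖ₑ ^ 2) K h volume
      ≤ eLpNorm' (fun v => ‖u v‖ₑ ^ 2) (1 - 2 * θ / d)⁻¹ volume * eLpNorm' K r volume *
          eLpNorm' h q volume :=
        convForm_le_eLpNorm' (hu.1.1.enorm.pow_const 2) hK hh hp₁ hr hq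
          (by rw [inv_inv, hrθ]; ring)
    _ ≤ ((∫⁻ v, ‖u v‖ₑ ^ 2) ^ (1 - θ) * (sobolevConst d * ∫⁻ v, ‖G v‖ₑ ^ 2) ^ θ) *
          eLpNorm' K r volume * eLpNorm' h q volume := by
        gcongr
        exact hu.eLpNorm'_sq_le_interpolation hd hθ₀ hθ₁ (inv_inv _)
    _ = _ := by ring

theorem IsH1WithGradient.lintegral_sq_lt_top (hu : IsH1WithGradient u G) :
    ∫⁻ v, ‖u v‖ₑ ^ 2 < ⊤ := by
  rw [← eLpNorm_two_sq]
  exact ENNReal.pow_lt_top hu.1.2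

theorem IsH1WithGradient.lintegral_grad_sq_lt_top (hu : IsH1WithGradient u G) :
    ∫⁻ v, ‖G v‖ₑ ^ 2 < ⊤ := by
  rw [← eLpNorm_two_sq]
  exact ENNReal.pow_lt_top hu.2.1.2

theorem IsH1WithGradient.convForm_sq_indicator_le (hd : 3 ≤ d) (hu : IsH1WithGradient u G)
    (hh : AEMeasurable h volume) {γ q s θ r c R : ℝ} (hq : 1 ≤ q) (hs : γ = d / q - d - 2 * s)
    (hθ₀ : 0 < θ) (hθ₁ : θ ≤ 1) (hr : 1 ≤ r) (hrθ : r⁻¹ = 1 - q⁻¹ + 2 * θ / d) (hc : 0 ≤ c)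
    (hR : 0 < R) {B : Set (EuclideanSpace ℝ (Fin d))} (hB : MeasurableSet B)
    (hB_int : ∫⁻ x in B, ENNReal.ofReal (‖x‖ ^ (γ * r)) =
      ENNReal.ofReal (c * R ^ (d + γ * r))) :
    convForm (fun v => ‖u v‖ₑ ^ 2) (B.indicator fun v => ENNReal.ofReal (‖v‖ ^ γ)) h volume ≤
      (c ^ (1 / r)).toNNReal * eLpNorm' h q volume *
        (ENNReal.ofReal (R ^ (2 * (θ - s))) *
          ((∫⁻ v, ‖u v‖ₑ ^ 2) ^ (1 - θ) * (sobolevConst d * ∫⁻ v, ‖G v‖ₑ ^ 2) ^ θ)) := by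
  have hd₀ : (d : ℝ) ≠ 0 := by positivity
  have hscale : γ + d / r = 2 * (θ - s) := by
    rw [div_eq_mul_inv, hrθ, hs]
    field_simp
    ring
  have hK := eLpNorm'_indicator_norm_rpow hB (γ := γ) (r := r) (by linarith) hc hR
    (by simpa only [finrank_euclideanSpace_fin] using hB_int)
  rw [finrank_euclideanSpace_fin, hscale] at hK
  have hK_meas : Measurable fun v : EuclideanSpace ℝ (Fin d) => ENNReal.ofReal (‖v‖ ^ γ) := by
    fun_prop
  refine (hu.convForm_sq_le hd (hK_meas.indicator hB).aemeasurable hh hq hr hθ₀.le hθ₁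
    hrθ).trans_eq ?_
  rw [hK, ENNReal.ofReal.eq_1 (c ^ (1 / r))]
  ring

theorem exists_riesz_exponent (hd : 0 < d) {γ q s θ : ℝ} (hq : 1 ≤ q)
    (hs : γ = d / q - d - 2 * s) (hθ₀ : 0 < θ) (hθq : θ ≤ d / (2 * q)) :
    ∃ r : ℝ, 1 ≤ r ∧ r⁻¹ = 1 - q⁻¹ + 2 * θ / d ∧ d + γ * r = 2 * (θ - s) * r := by
  have hd' : (0 : ℝ) < d := by exact_mod_cast hd
  have hq_inv : q⁻¹ ≤ 1 := inv_le_one_of_one_le₀ hq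
  have hpos : 0 < 1 - q⁻¹ + 2 * θ / d := by
    linarith [show 0 < 2 * θ / d by positivity]
  have hle : 2 * θ / d ≤ q⁻¹ := by
    rw [le_div_iff₀ (by positivity)] at hθq
    rw [div_le_iff₀ hd', inv_mul_eq_div, le_div_iff₀ (by positivity)]
    linarith
  refine ⟨(1 - q⁻¹ + 2 * θ / d)⁻¹, (one_le_inv₀ hpos).2 (by linarith), inv_inv _, ?_⟩
  rw [← sub_eq_zero, ← mul_right_inj' hpos.ne', mul_zero, mul_sub, mul_add,
    mul_left_comm _ γ, mul_left_comm _ (2 * (θ - s)), mul_inv_cancel₀ hpos.ne', hs]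
  field_simp
  ring

theorem nontrivial_euclideanSpace (hd : 0 < d) : Nontrivial (EuclideanSpace ℝ (Fin d)) :=
  Module.nontrivial_of_finrank_pos (R := ℝ) (by rwa [finrank_euclideanSpace_fin])

theorem exists_convForm_sq_ball_le (hd : 3 ≤ d) {γ q s θ : ℝ} (hq : 1 ≤ q)
    (hs : γ = d / q - d - 2 * s) (hs₀ : 0 < s) (hsθ : s < θ) (hθ₁ : θ ≤ 1)
    (hθq : θ ≤ d / (2 * q)) :
    ∃ κ : ℝ≥0, ∀ {u : EuclideanSpace ℝ (Fin d) → ℝ}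
      {G : EuclideanSpace ℝ (Fin d) → EuclideanSpace ℝ (Fin d)}
      {h : EuclideanSpace ℝ (Fin d) → ℝ≥0∞} {R : ℝ}, IsH1WithGradient u G →
      AEMeasurable h volume → 0 < R →
      convForm (fun v => ‖u v‖ₑ ^ 2)
          ((Metric.ball 0 R).indicator fun v => ENNReal.ofReal (‖v‖ ^ γ)) h volume ≤
        κ * eLpNorm' h q volume * (ENNReal.ofReal (R ^ (2 * (θ - s))) *
          ((∫⁻ v, ‖u v‖ₑ ^ 2) ^ (1 - θ) * (sobolevConst d * ∫⁻ v, ‖G v‖ₑ ^ 2) ^ θ)) := by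
  have := nontrivial_euclideanSpace (d := d) (by omega)
  obtain ⟨r, hr, hr_inv, hr_eq⟩ := exists_riesz_exponent (by omega) hq hs (hs₀.trans hsθ) hθq
  have hdim : 0 < d + γ * r := by
    rw [hr_eq]
    exact mul_pos (by linarith) (by linarith)
  obtain ⟨ρ, hρ_eq⟩ : ∃ ρ : ℝ, ρ =
      d * volume.real (Metric.ball (0 : EuclideanSpace ℝ (Fin d)) 1) / (d + γ * r) := ⟨_, rfl⟩
  have hρ : 0 ≤ ρ := hρ_eq ▸ div_nonneg (by positivity) (by linarith)
  have hint {R : ℝ} (hR : 0 < R) :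
      ∫⁻ x in Metric.ball (0 : EuclideanSpace ℝ (Fin d)) R, ENNReal.ofReal (‖x‖ ^ (γ * r)) =
        ENNReal.ofReal (ρ * R ^ (d + γ * r)) := by
    have h := setLIntegral_ball_norm_rpow (E := EuclideanSpace ℝ (Fin d)) (μ := volume)
      (a := γ * r) (by rwa [finrank_euclideanSpace_fin]) hR
    rwa [finrank_euclideanSpace_fin, ← hρ_eq] at h
  exact ⟨(ρ ^ (1 / r)).toNNReal, fun hu hh hR =>
    hu.convForm_sq_indicator_le hd hh hq hs (hs₀.trans hsθ) hθ₁ hr hr_inv hρ hR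
      measurableSet_ball (hint hR)⟩

theorem exists_convForm_sq_compl_ball_le (hd : 3 ≤ d) {γ q s θ : ℝ} (hq : 1 ≤ q)
    (hs : γ = d / q - d - 2 * s) (hθ₀ : 0 < θ) (hθs : θ < s) (hθ₁ : θ ≤ 1)
    (hθq : θ ≤ d / (2 * q)) :
    ∃ κ : ℝ≥0, ∀ {u : EuclideanSpace ℝ (Fin d) → ℝ}
      {G : EuclideanSpace ℝ (Fin d) → EuclideanSpace ℝ (Fin d)}
      {h : EuclideanSpace ℝ (Fin d) → ℝ≥0∞} {R : ℝ}, IsH1WithGradient u G →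
      AEMeasurable h volume → 0 < R →
      convForm (fun v => ‖u v‖ₑ ^ 2)
          ((Metric.ball 0 R)ᶜ.indicator fun v => ENNReal.ofReal (‖v‖ ^ γ)) h volume ≤
        κ * eLpNorm' h q volume * (ENNReal.ofReal (R ^ (2 * (θ - s))) *
          ((∫⁻ v, ‖u v‖ₑ ^ 2) ^ (1 - θ) * (sobolevConst d * ∫⁻ v, ‖G v‖ₑ ^ 2) ^ θ)) := by
  have := nontrivial_euclideanSpace (d := d) (by omega)
  obtain ⟨r, hr, hr_inv, hr_eq⟩ := exists_riesz_exponent (by omega) hq hs hθ₀ hθq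
  have hdim : d + γ * r < 0 := by
    rw [hr_eq]
    exact mul_neg_of_neg_of_pos (by linarith) (by linarith)
  obtain ⟨ρ, hρ_eq⟩ : ∃ ρ : ℝ, ρ =
      d * volume.real (Metric.ball (0 : EuclideanSpace ℝ (Fin d)) 1) / -(d + γ * r) := ⟨_, rfl⟩
  have hρ : 0 ≤ ρ := hρ_eq ▸ div_nonneg (by positivity) (by linarith)
  have hint {R : ℝ} (hR : 0 < R) :
      ∫⁻ x in (Metric.ball (0 : EuclideanSpace ℝ (Fin d)) R)ᶜ, ENNReal.ofReal (‖x‖ ^ (γ * r)) =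
        ENNReal.ofReal (ρ * R ^ (d + γ * r)) := by
    have h := setLIntegral_compl_ball_norm_rpow (E := EuclideanSpace ℝ (Fin d)) (μ := volume)
      (a := γ * r) (by rwa [finrank_euclideanSpace_fin]) hR
    rwa [finrank_euclideanSpace_fin, ← hρ_eq] at h
  exact ⟨(ρ ^ (1 / r)).toNNReal, fun hu hh hR =>
    hu.convForm_sq_indicator_le hd hh hq hs hθ₀ hθ₁ hr hr_inv hρ hR
      measurableSet_ball.compl (hint hR)⟩

theorem exists_convForm_riesz_le (hd : 3 ≤ d) {γ q s : ℝ} (hγ : -(d : ℝ) < γ) (hq : 1 ≤ q)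
    (hs : γ = d / q - d - 2 * s) (hs₀ : 0 < s) (hs₁ : s < 1) :
    ∃ κ : ℝ≥0, ∀ (u : EuclideanSpace ℝ (Fin d) → ℝ)
      (G : EuclideanSpace ℝ (Fin d) → EuclideanSpace ℝ (Fin d))
      (h : EuclideanSpace ℝ (Fin d) → ℝ≥0∞), IsH1WithGradient u G → AEMeasurable h volume →
      convForm (fun v => ‖u v‖ₑ ^ 2) (fun v => ENNReal.ofReal (‖v‖ ^ γ)) h volume ≤
        κ * (eLpNorm' h q volume * ((∫⁻ v, ‖u v‖ₑ ^ 2) ^ (1 - s) * (∫⁻ v, ‖G v‖ₑ ^ 2) ^ s)) := by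
  have hs_lt : s < d / (2 * q) := by
    have : (d : ℝ) / (2 * q) = d / q / 2 := by rw [mul_comm, div_mul_eq_div_div]
    linarith
  obtain ⟨θ, hsθ, hθ_lt⟩ := exists_between (lt_min hs₁ hs_lt)
  obtain ⟨hθ₁, hθq⟩ := lt_min_iff.1 hθ_lt
  obtain ⟨κ₁, hnear⟩ := exists_convForm_sq_ball_le hd hq hs hs₀ hsθ hθ₁.le hθq.le
  obtain ⟨κ₂, hfar⟩ := exists_convForm_sq_compl_ball_le hd hq hs (half_pos hs₀) (half_lt_self hs₀)
    (by linarith) (by linarith)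
  refine ⟨(κ₁ + κ₂) * sobolevConst d ^ s, fun u G h hu hh => ?_⟩
  set k : EuclideanSpace ℝ (Fin d) → ℝ≥0∞ := fun v => ENNReal.ofReal (‖v‖ ^ γ)
  set X := ∫⁻ v, ‖u v‖ₑ ^ 2
  set Y := ∫⁻ v, ‖G v‖ₑ ^ 2
  obtain ⟨R, hR, hscale⟩ := exists_scale_rpow_mul_interpolation_le hu.lintegral_sq_lt_top.ne
    (ENNReal.mul_lt_top coe_lt_top hu.lintegral_grad_sq_lt_top : sobolevConst d * Y < ⊤).ne s
  have hk : Measurable k := by fun_prop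
  calc convForm (fun v => ‖u v‖ₑ ^ 2) k h volume
      = convForm (fun v => ‖u v‖ₑ ^ 2) ((Metric.ball 0 R).indicator k) h volume +
          convForm (fun v => ‖u v‖ₑ ^ 2) ((Metric.ball 0 R)ᶜ.indicator k) h volume := by
        rw [← convForm_add (hu.1.1.enorm.pow_const 2)
          (hk.indicator measurableSet_ball).aemeasurable hh,
          Set.indicator_self_add_compl]
    _ ≤ κ₁ * eLpNorm' h q volume * (X ^ (1 - s) * (sobolevConst d * Y) ^ s) +
        κ₂ * eLpNorm' h q volume * (X ^ (1 - s) * (sobolevConst d * Y) ^ s) := by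
        refine add_le_add ((hnear hu hh hR).trans (mul_le_mul' le_rfl ?_))
          ((hfar hu hh hR).trans (mul_le_mul' le_rfl ?_))
        · exact hscale θ ⟨hs₀.trans hsθ, hθ₁⟩
        · exact hscale (s / 2) ⟨half_pos hs₀, by linarith⟩
    _ = _ := by
        rw [ENNReal.mul_rpow_of_nonneg _ _ hs₀.le, ENNReal.coe_mul, ENNReal.coe_add,
          ← ENNReal.coe_rpow_of_nonneg _ hs₀.le]
        ring

end Riesz

section Potential

theorem IsH1WithGradient.lintegral_sq_mul_le {d : ℕ} {u : EuclideanSpace ℝ (Fin d) → ℝ}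
    {G : EuclideanSpace ℝ (Fin d) → EuclideanSpace ℝ (Fin d)}
    {h : EuclideanSpace ℝ (Fin d) → ℝ≥0∞} (hd : 3 ≤ d) (hu : IsH1WithGradient u G)
    (hh : AEMeasurable h volume) {q s : ℝ} (hq : (d : ℝ) / 2 < q) (hs : s = d / (2 * q)) :
    ∫⁻ v, ‖u v‖ₑ ^ 2 * h v ≤ (sobolevConst d ^ s : ℝ≥0) *
      (eLpNorm' h q volume * ((∫⁻ v, ‖u v‖ₑ ^ 2) ^ (1 - s) * (∫⁻ v, ‖G v‖ₑ ^ 2) ^ s)) := by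
  have hd' : (3 : ℝ) ≤ d := by exact_mod_cast hd
  have hq₁ : 1 < q := by linarith
  have hs₀ : 0 ≤ s := by
    rw [hs]
    positivity
  have hs₁ : s ≤ 1 := by
    rw [hs, div_le_one (by linarith)]
    linarith
  have hpq := (Real.HolderConjugate.conjExponent hq₁).symm
  have hp : q.conjExponent⁻¹ = 1 - 2 * s / d := by
    rw [← hpq.symm.one_sub_inv, hs]
    field_simp
  calc ∫⁻ v, ‖u v‖ₑ ^ 2 * h v
      ≤ eLpNorm' (fun v => ‖u v‖ₑ ^ 2) q.conjExponent volume * eLpNorm' h q volume := by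
        simpa [eLpNorm'_eq_lintegral_enorm] using
          ENNReal.lintegral_mul_le_Lp_mul_Lq volume hpq (hu.1.1.enorm.pow_const 2) hh
    _ ≤ (∫⁻ v, ‖u v‖ₑ ^ 2) ^ (1 - s) * (sobolevConst d * ∫⁻ v, ‖G v‖ₑ ^ 2) ^ s *
          eLpNorm' h q volume := by
        gcongr
        exact hu.eLpNorm'_sq_le_interpolation hd hs₀ hs₁ hp
    _ = _ := by
        rw [ENNReal.mul_rpow_of_nonneg _ _ hs₀, ENNReal.coe_rpow_of_nonneg _ hs₀]
        ring

theorem ae_lintegral_norm_sub_rpow_mul_lt_top {E : Type*} [NormedAddCommGroup E] [NormedSpace ℝ E]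
    [FiniteDimensional ℝ E] [Nontrivial E] [MeasurableSpace E] [BorelSpace E] {μ : Measure E}
    [μ.IsAddHaarMeasure] {γ : ℝ} (hγ : 0 < Module.finrank ℝ E + γ) (hγ₀ : γ ≤ 0) {h : E → ℝ≥0∞}
    (hh : AEMeasurable h μ) (hh_int : ∫⁻ x, h x ∂μ < ⊤) :
    ∀ᵐ x ∂μ, ∫⁻ y, ENNReal.ofReal (‖x - y‖ ^ γ) * h y ∂μ < ⊤ := by
  set k : E → ℝ≥0∞ := (Metric.ball 0 1).indicator fun x => ENNReal.ofReal (‖x‖ ^ γ) with hk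
  have hk_meas : Measurable k := by
    have : Measurable fun x : E => ENNReal.ofReal (‖x‖ ^ γ) := by fun_prop
    exact this.indicator measurableSet_ball
  have hprod : AEMeasurable (fun z : E × E => k (z.1 - z.2) * h z.2) (μ.prod μ) :=
    (aemeasurable_comp_sub hk_meas.aemeasurable).mul hh.comp_snd
  have hlocal : ∀ᵐ x ∂μ, ∫⁻ y, k (x - y) * h y ∂μ < ⊤ := by
    refine ae_lt_top' hprod.lintegral_prod_right' ?_
    rw [← lintegral_prod _ hprod, lintegral_prod_comp_sub_mul hk_meas.aemeasurable hh,
      hk, lintegral_indicator measurableSet_ball, setLIntegral_ball_norm_rpow hγ one_pos]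
    exact ENNReal.mul_ne_top ofReal_ne_top hh_int.ne
  have hkernel (z : E) : ENNReal.ofReal (‖z‖ ^ γ) ≤ k z + 1 := by
    by_cases hz : z ∈ Metric.ball 0 1
    · simp [hk, Set.indicator_of_mem hz]
    · rw [mem_ball_zero_iff, not_lt] at hz
      exact (ENNReal.ofReal_le_one.2
        (Real.rpow_le_one_of_one_le_of_nonpos hz hγ₀)).trans le_add_self
  filter_upwards [hlocal] with x hx
  calc ∫⁻ y, ENNReal.ofReal (‖x - y‖ ^ γ) * h y ∂μ ≤ ∫⁻ y, (k (x - y) * h y + h y) ∂μ := by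
        refine lintegral_mono fun y => ?_
        rw [← add_one_mul]
        gcongr
        exact hkernel _
    _ = ∫⁻ y, k (x - y) * h y ∂μ + ∫⁻ y, h y ∂μ := lintegral_add_right' _ hh
    _ < ⊤ := ENNReal.add_lt_top.2 ⟨hx, hh_int⟩

theorem ae_integrable_norm_sub_rpow_mul {E : Type*} [NormedAddCommGroup E] [NormedSpace ℝ E]
    [FiniteDimensional ℝ E] [Nontrivial E] [MeasurableSpace E] [BorelSpace E] {μ : Measure E}
    [μ.IsAddHaarMeasure] {γ : ℝ} (hγ : 0 < Module.finrank ℝ E + γ) (hγ₀ : γ ≤ 0) {g : E → ℝ}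
    (hg : Integrable g μ) : ∀ᵐ x ∂μ, Integrable (fun y => ‖x - y‖ ^ γ * g y) μ := by
  filter_upwards [ae_lintegral_norm_sub_rpow_mul_lt_top hγ hγ₀ hg.1.enorm hg.2] with x hx
  have hkernel : Measurable fun y => ‖x - y‖ ^ γ := by fun_prop
  refine ⟨hkernel.aestronglyMeasurable.mul hg.1, lt_of_eq_of_lt (lintegral_congr fun y => ?_) hx⟩
  rw [enorm_mul, Real.enorm_of_nonneg (by positivity)]

end Potential

section Weights

variable {d : ℕ} {γ : ℝ} {φ g : EuclideanSpace ℝ (Fin d) → ℝ}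

theorem bracket_pos (v : EuclideanSpace ℝ (Fin d)) : 0 < bracket v :=
  Real.sqrt_pos.2 (by positivity)

theorem measurable_bracket : Measurable (bracket : EuclideanSpace ℝ (Fin d) → ℝ) :=
  ((measurable_norm.pow_const 2).const_add 1).sqrt

theorem bracket_le_bracket_add (v w : EuclideanSpace ℝ (Fin d)) :
    bracket v ≤ bracket w + ‖v - w‖ := by
  have hw : ‖w‖ ≤ bracket w := Real.le_sqrt_of_sq_le (by linarith)
  have hw_sq : bracket w ^ 2 = 1 + ‖w‖ ^ 2 := Real.sq_sqrt (by positivity)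
  have hv : ‖v‖ ≤ ‖w‖ + ‖v - w‖ := by simpa using norm_add_le w (v - w)
  refine Real.sqrt_le_iff.2 ⟨add_nonneg (bracket_pos w).le (norm_nonneg _), ?_⟩
  nlinarith [norm_nonneg (v - w), norm_nonneg v, norm_nonneg w]

-- Either `|v - w| ≥ ⟨v⟩ / 2`, and the kernel absorbs the weight, or `⟨v⟩ ≤ 2⟨w⟩`, and the weight
-- moves to `w`.
theorem bracket_rpow_mul_norm_sub_rpow_le (hγ : γ ≤ 0) (v w : EuclideanSpace ℝ (Fin d)) :
    bracket v ^ (-γ) * ‖v - w‖ ^ γ ≤ 2 ^ (-γ) * (1 + ‖v - w‖ ^ γ * bracket w ^ (-γ)) := by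
  have hv := bracket_pos v
  have hw := bracket_pos w
  rw [mul_one_add]
  rcases le_or_gt (bracket v / 2) ‖v - w‖ with hfar | hnear
  · refine le_add_of_le_of_nonneg ?_ (by positivity)
    calc bracket v ^ (-γ) * ‖v - w‖ ^ γ ≤ bracket v ^ (-γ) * (bracket v / 2) ^ γ := by
          gcongr ?_ * ?_
          exact Real.rpow_le_rpow_of_nonpos (by positivity) hfar hγ
      _ = 2 ^ (-γ) := by
          rw [Real.div_rpow hv.le zero_le_two, Real.rpow_neg hv.le, Real.rpow_neg zero_le_two]
          field_simp
  · refine le_add_of_nonneg_of_le (by positivity) ?_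
    calc bracket v ^ (-γ) * ‖v - w‖ ^ γ ≤ (2 * bracket w) ^ (-γ) * ‖v - w‖ ^ γ := by
          gcongr ?_ * _
          exact Real.rpow_le_rpow hv.le (by linarith [bracket_le_bracket_add v w])
            (neg_nonneg.2 hγ)
      _ = 2 ^ (-γ) * (‖v - w‖ ^ γ * bracket w ^ (-γ)) := by
          rw [Real.mul_rpow zero_le_two hw.le]
          ring

theorem enorm_sq_eq_bracket_rpow_mul (γ : ℝ) (φ : EuclideanSpace ℝ (Fin d) → ℝ)
    (v : EuclideanSpace ℝ (Fin d)) :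
    ‖φ v‖ₑ ^ 2 = ENNReal.ofReal (bracket v ^ (-γ)) * ‖bracket v ^ (γ / 2) * φ v‖ₑ ^ 2 := by
  have hv := bracket_pos v
  rw [enorm_mul, mul_pow, ← mul_assoc, Real.enorm_of_nonneg (Real.rpow_nonneg hv.le (γ / 2)),
    ← ENNReal.ofReal_pow (by positivity), ← ENNReal.ofReal_mul (by positivity),
    ← Real.rpow_natCast, ← Real.rpow_mul hv.le, ← Real.rpow_add hv]
  norm_num

theorem aestronglyMeasurable_of_bracket_rpow_mul
    (h : AEStronglyMeasurable (fun v => bracket v ^ γ * φ v) volume) :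
    AEStronglyMeasurable φ volume := by
  refine ((measurable_bracket.pow_const (-γ)).aestronglyMeasurable.mul h).congr
    (ae_of_all _ fun v => ?_)
  have hv := bracket_pos v
  simp only [Pi.mul_apply]
  rw [← mul_assoc, ← Real.rpow_add hv, neg_add_cancel, Real.rpow_zero, one_mul]

theorem lintegral_enorm_sq_eq {α F : Type*} [MeasurableSpace α] {μ : Measure α}
    [NormedAddCommGroup F] {f : α → F} (hf : MemLp f 2 μ) :
    ∫⁻ v, ‖f v‖ₑ ^ 2 ∂μ = ENNReal.ofReal (∫ v, ‖f v‖ ^ 2 ∂μ) := by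
  rw [ofReal_integral_eq_lintegral_ofReal (hf.integrable_norm_pow two_ne_zero)
    (ae_of_all _ fun v => by positivity)]
  simp only [ENNReal.ofReal_pow (norm_nonneg _), ofReal_norm]

theorem lintegral_enorm_sq_bracket_rpow_mul
    (h : MemLp (fun v => bracket v ^ (γ / 2) * φ v) 2 volume) :
    ∫⁻ v, ‖bracket v ^ (γ / 2) * φ v‖ₑ ^ 2 =
      ENNReal.ofReal (∫ v, φ v ^ 2 * bracket v ^ γ) := by
  rw [lintegral_enorm_sq_eq h]
  congr with v
  have hv := bracket_pos v
  rw [Real.norm_eq_abs, sq_abs, mul_pow, ← Real.rpow_natCast (bracket v ^ _),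
    ← Real.rpow_mul hv.le, mul_comm]
  norm_num

theorem eLpNorm'_bracket_rpow_mul_enorm {q k : ℝ} (hq : 0 < q) (hg : MemWeightedLp q (q * k) g) :
    eLpNorm' (fun w => ENNReal.ofReal (bracket w ^ k) * ‖g w‖ₑ) q volume =
      ENNReal.ofReal (weightedLpNorm q (q * k) g) := by
  have hnonneg (v : EuclideanSpace ℝ (Fin d)) : 0 ≤ |g v| ^ q * bracket v ^ (q * k) :=
    mul_nonneg (by positivity) (Real.rpow_nonneg (bracket_pos v).le _)
  rw [weightedLpNorm, ← ENNReal.ofReal_rpow_of_nonneg (integral_nonneg hnonneg) (by positivity),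
    ofReal_integral_eq_lintegral_ofReal hg.2 (ae_of_all _ hnonneg), eLpNorm'_eq_lintegral_enorm]
  congr with w
  have hw := bracket_pos w
  rw [enorm_eq_self, ← ofReal_norm, ← ENNReal.ofReal_mul (by positivity),
    ENNReal.ofReal_rpow_of_nonneg (by positivity) hq.le,
    Real.mul_rpow (by positivity) (by positivity), ← Real.rpow_mul hw.le, Real.norm_eq_abs,
    mul_comm k q, mul_comm]

theorem convForm_sq_le_weighted (hγ : γ ≤ 0)
    (hφ : AEStronglyMeasurable (fun v => bracket v ^ (γ / 2) * φ v) volume)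
    (hg : AEStronglyMeasurable g volume) :
    convForm (fun v => ‖φ v‖ₑ ^ 2) (fun z => ENNReal.ofReal (‖z‖ ^ γ)) (fun w => ‖g w‖ₑ) volume ≤
      ENNReal.ofReal (2 ^ (-γ)) *
        ((∫⁻ w, ‖g w‖ₑ) * (∫⁻ v, ‖bracket v ^ (γ / 2) * φ v‖ₑ ^ 2) +
          convForm (fun v => ‖bracket v ^ (γ / 2) * φ v‖ₑ ^ 2)
            (fun z => ENNReal.ofReal (‖z‖ ^ γ))
            (fun w => ENNReal.ofReal (bracket w ^ (-γ)) * ‖g w‖ₑ) volume) := by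
  set U : EuclideanSpace ℝ (Fin d) → ℝ≥0∞ := fun v => ‖bracket v ^ (γ / 2) * φ v‖ₑ ^ 2
  set K : EuclideanSpace ℝ (Fin d) → ℝ≥0∞ := fun z => ENNReal.ofReal (‖z‖ ^ γ) with hK
  set b : EuclideanSpace ℝ (Fin d) → ℝ≥0∞ := fun w => ENNReal.ofReal (bracket w ^ (-γ)) with hb
  have hkernel (v w : EuclideanSpace ℝ (Fin d)) :
      b v * K (v - w) ≤ ENNReal.ofReal (2 ^ (-γ)) * (1 + K (v - w) * b w) := by
    have hv := bracket_pos v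
    have hw := bracket_pos w
    simp only [hK, hb]
    rw [← ENNReal.ofReal_mul (by positivity), ← ENNReal.ofReal_mul (by positivity),
      ← ENNReal.ofReal_one, ← ENNReal.ofReal_add zero_le_one (by positivity),
      ← ENNReal.ofReal_mul (by positivity)]
    exact ENNReal.ofReal_le_ofReal (bracket_rpow_mul_norm_sub_rpow_le hγ v w)
  calc convForm (fun v => ‖φ v‖ₑ ^ 2) K (fun w => ‖g w‖ₑ) volume
      ≤ ∫⁻ v, ∫⁻ w, ENNReal.ofReal (2 ^ (-γ)) *
          (‖g w‖ₑ * U v + U v * K (v - w) * (b w * ‖g w‖ₑ)) := by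
        refine lintegral_mono fun v => lintegral_mono fun w => ?_
        calc ‖φ v‖ₑ ^ 2 * K (v - w) * ‖g w‖ₑ = b v * K (v - w) * (U v * ‖g w‖ₑ) := by
              rw [enorm_sq_eq_bracket_rpow_mul γ φ v]
              ring
          _ ≤ ENNReal.ofReal (2 ^ (-γ)) * (1 + K (v - w) * b w) * (U v * ‖g w‖ₑ) := by
              gcongr ?_ * _
              exact hkernel v w
          _ = _ := by ring
    _ = _ := by
        have hU : AEMeasurable U volume := hφ.enorm.pow_const 2
        simp only [lintegral_const_mul' _ _ ofReal_ne_top,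
          lintegral_add_left' (hg.enorm.mul_const _), lintegral_mul_const'' _ hg.enorm]
        rw [lintegral_add_left' (hU.const_mul _), lintegral_const_mul'' _ hU]
        rfl

end Weights

section Estimates

theorem mul_rpow_mul_rpow_le {A X Y s ε : ℝ} (hA : 0 ≤ A) (hX : 0 ≤ X) (hY : 0 ≤ Y) (hs₀ : 0 ≤ s)
    (hs₁ : s < 1) (hε : 0 < ε) :
    A * (X ^ (1 - s) * Y ^ s) ≤ ε * Y + ε ^ (-(s / (1 - s))) * A ^ (1 / (1 - s)) * X := by
  have hs : 0 < 1 - s := sub_pos.2 hs₁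
  obtain ⟨B, hB⟩ : ∃ B, B = ε ^ (-(s / (1 - s))) * A ^ (1 / (1 - s)) := ⟨_, rfl⟩
  have hB₀ : 0 ≤ B := hB ▸ by positivity
  have hscale : B ^ (1 - s) * ε ^ s = A := by
    rw [hB, Real.mul_rpow (by positivity) (by positivity), ← Real.rpow_mul hε.le,
      ← Real.rpow_mul hA, neg_mul, div_mul_cancel₀ _ hs.ne', div_mul_cancel₀ _ hs.ne',
      Real.rpow_one, mul_right_comm, ← Real.rpow_add hε, neg_add_cancel, Real.rpow_zero, one_mul]
  rw [← hB]
  calc A * (X ^ (1 - s) * Y ^ s) = (B * X) ^ (1 - s) * (ε * Y) ^ s := by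
        rw [Real.mul_rpow hB₀ hX, Real.mul_rpow hε.le hY, ← hscale]
        ring
    _ ≤ (1 - s) * (B * X) + s * (ε * Y) :=
        Real.geom_mean_le_arith_mean2_weighted hs.le hs₀ (mul_nonneg hB₀ hX)
          (mul_nonneg hε.le hY) (by ring)
    _ ≤ ε * Y + B * X := by nlinarith [mul_nonneg hB₀ hX, mul_nonneg hε.le hY]

theorem mul_add_rpow_mul_rpow_le {C N H X Y s ε : ℝ} (hC : 0 ≤ C) (hN : 0 ≤ N) (hH : 0 ≤ H)
    (hX : 0 ≤ X) (hY : 0 ≤ Y) (hs₀ : 0 ≤ s) (hs₁ : s < 1) (hε : 0 < ε) :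
    C * (N * X + H * (X ^ (1 - s) * Y ^ s)) ≤ ε * Y +
      (1 + C) ^ (1 / (1 - s)) * (N + ε ^ (-(s / (1 - s))) * H ^ (1 / (1 - s))) * X := by
  have hs : 1 ≤ 1 / (1 - s) := one_le_one_div (sub_pos.2 hs₁) (by linarith)
  have hlinear : C ≤ (1 + C) ^ (1 / (1 - s)) :=
    (le_add_of_nonneg_left zero_le_one).trans (Real.self_le_rpow_of_one_le (by linarith) hs)
  have hpower : C ^ (1 / (1 - s)) ≤ (1 + C) ^ (1 / (1 - s)) := by gcongr; linarith
  calc C * (N * X + H * (X ^ (1 - s) * Y ^ s))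
      = C * N * X + C * H * (X ^ (1 - s) * Y ^ s) := by ring
    _ ≤ C * N * X + (ε * Y + ε ^ (-(s / (1 - s))) * (C * H) ^ (1 / (1 - s)) * X) := by
        gcongr
        exact mul_rpow_mul_rpow_le (mul_nonneg hC hH) hX hY hs₀ hs₁ hε
    _ ≤ (1 + C) ^ (1 / (1 - s)) * N * X + (ε * Y + ε ^ (-(s / (1 - s))) *
          ((1 + C) ^ (1 / (1 - s)) * H ^ (1 / (1 - s))) * X) := by
        rw [Real.mul_rpow hC hH]
        gcongr
    _ = _ := by ring

theorem integrable_and_integral_abs_le {α : Type*} [MeasurableSpace α] {μ : Measure α} {f : α → ℝ}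
    {C : ℝ≥0} {N H X Y s : ℝ} (hf : AEStronglyMeasurable f μ) (hN : 0 ≤ N) (hH : 0 ≤ H)
    (hX : 0 ≤ X) (hY : 0 ≤ Y) (hs₀ : 0 ≤ s) (hs₁ : s < 1)
    (hle : ∫⁻ v, ‖f v‖ₑ ∂μ ≤ C * (ENNReal.ofReal N * ENNReal.ofReal X +
      ENNReal.ofReal H * (ENNReal.ofReal X ^ (1 - s) * ENNReal.ofReal Y ^ s))) :
    Integrable f μ ∧ ∀ ε : ℝ, 0 < ε → ∫ v, |f v| ∂μ ≤ ε * Y +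
      (1 + (C : ℝ)) ^ (1 / (1 - s)) * (N + ε ^ (-(s / (1 - s))) * H ^ (1 / (1 - s))) * X := by
  have hbound : ∫⁻ v, ‖f v‖ₑ ∂μ ≤ ENNReal.ofReal (C * (N * X + H * (X ^ (1 - s) * Y ^ s))) := by
    rwa [ENNReal.ofReal_mul C.coe_nonneg, ENNReal.ofReal_add (by positivity) (by positivity),
      ENNReal.ofReal_mul hN, ENNReal.ofReal_mul hH, ENNReal.ofReal_mul (by positivity),
      ← ENNReal.ofReal_rpow_of_nonneg hX (by linarith), ← ENNReal.ofReal_rpow_of_nonneg hY hs₀,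
      ENNReal.ofReal_coe_nnreal]
  refine ⟨⟨hf, hbound.trans_lt ofReal_lt_top⟩, fun ε hε => le_trans ?_
    (mul_add_rpow_mul_rpow_le C.coe_nonneg hN hH hX hY hs₀ hs₁ hε)⟩
  refine (integral_norm_eq_lintegral_enorm hf).trans_le ?_
  exact ENNReal.toReal_le_of_le_ofReal (by positivity) hbound

variable {d : ℕ} {γ q s : ℝ} {φ g : EuclideanSpace ℝ (Fin d) → ℝ}

theorem weightedLpNorm_nonneg (q k : ℝ) (g : EuclideanSpace ℝ (Fin d) → ℝ) :
    0 ≤ weightedLpNorm q k g :=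
  Real.rpow_nonneg (integral_nonneg fun v =>
    mul_nonneg (by positivity) (Real.rpow_nonneg (bracket_pos v).le _)) _

theorem integral_sq_mul_bracket_rpow_nonneg (φ : EuclideanSpace ℝ (Fin d) → ℝ) (γ : ℝ) :
    0 ≤ ∫ v, φ v ^ 2 * bracket v ^ γ :=
  integral_nonneg fun v => mul_nonneg (sq_nonneg _) (Real.rpow_nonneg (bracket_pos v).le _)

theorem aestronglyMeasurable_cCoeff (hg : AEStronglyMeasurable g volume) :
    AEStronglyMeasurable (cCoeff γ g) volume := by
  unfold cCoeff
  split_ifs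
  · exact hg.const_mul _
  · have hkernel : Measurable fun z : EuclideanSpace ℝ (Fin d) × EuclideanSpace ℝ (Fin d) =>
        ‖z.1 - z.2‖ ^ γ := by fun_prop
    exact ((hkernel.aestronglyMeasurable.mul hg.comp_snd).integral_prod_right').const_mul _

theorem aestronglyMeasurable_sq_mul_cCoeff {k : ℝ}
    (hφ : AEStronglyMeasurable (fun v => bracket v ^ k * φ v) volume)
    (hg : AEStronglyMeasurable g volume) :
    AEStronglyMeasurable (fun v => φ v ^ 2 * cCoeff γ g v) volume :=
  ((aestronglyMeasurable_of_bracket_rpow_mul hφ).pow 2).mul (aestronglyMeasurable_cCoeff hg)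

theorem lintegral_sq_mul_cCoeff_le_convForm (hγ : γ ≠ -(d : ℝ))
    (φ g : EuclideanSpace ℝ (Fin d) → ℝ) :
    ∫⁻ v, ‖φ v ^ 2 * cCoeff γ g v‖ₑ ≤ ‖((d : ℝ) - 1) * (γ + d)‖ₑ *
      convForm (fun v => ‖φ v‖ₑ ^ 2) (fun z => ENNReal.ofReal (‖z‖ ^ γ)) (fun w => ‖g w‖ₑ)
        volume := by
  rw [convForm, ← lintegral_const_mul' _ _ enorm_ne_top]
  refine lintegral_mono fun v => ?_
  simp only [cCoeff, if_neg hγ, mul_assoc]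
  rw [lintegral_const_mul' _ _ (by finiteness), enorm_mul, enorm_mul,
    enorm_neg, enorm_pow, mul_left_comm]
  gcongr
  refine (enorm_integral_le_lintegral_enorm _).trans_eq (lintegral_congr fun w => ?_)
  rw [enorm_mul, Real.enorm_of_nonneg (by positivity)]

theorem lintegral_sq_mul_cCoeff_neg_dim (φ g : EuclideanSpace ℝ (Fin d) → ℝ) :
    ∫⁻ v, ‖φ v ^ 2 * cCoeff (-(d : ℝ)) g v‖ₑ =
      ‖((d : ℝ) - 1) * ((d : ℝ) - 2) * sphereArea d‖ₑ *
        ∫⁻ v, ‖bracket v ^ (-(d : ℝ) / 2) * φ v‖ₑ ^ 2 *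
          (ENNReal.ofReal (bracket v ^ (d : ℝ)) * ‖g v‖ₑ) := by
  rw [← lintegral_const_mul' _ _ enorm_ne_top]
  refine lintegral_congr fun v => ?_
  simp only [cCoeff, if_true]
  rw [enorm_mul, enorm_mul (-_) (g v), enorm_neg, enorm_pow,
    enorm_sq_eq_bracket_rpow_mul (-(d : ℝ)) φ v, neg_neg]
  ring

theorem exists_lintegral_sq_mul_cCoeff_le (hd : 3 ≤ d) (hγ : -(d : ℝ) < γ) (hγ₀ : γ ≤ 0)
    (hq : 1 ≤ q) (hs : γ = d / q - d - 2 * s) (hs₀ : 0 < s) (hs₁ : s < 1) :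
    ∃ C : ℝ≥0, ∀ (φ g : EuclideanSpace ℝ (Fin d) → ℝ)
      (G : EuclideanSpace ℝ (Fin d) → EuclideanSpace ℝ (Fin d)),
      IsH1WithGradient (fun v => bracket v ^ (γ / 2) * φ v) G → Integrable g →
      MemWeightedLp q (q * |γ|) g →
      ∫⁻ v, ‖φ v ^ 2 * cCoeff γ g v‖ₑ ≤
        C * (ENNReal.ofReal (∫ v, |g v|) * ENNReal.ofReal (∫ v, φ v ^ 2 * bracket v ^ γ) +
          ENNReal.ofReal (weightedLpNorm q (q * |γ|) g) *
            (ENNReal.ofReal (∫ v, φ v ^ 2 * bracket v ^ γ) ^ (1 - s) *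
              ENNReal.ofReal (∫ v, ‖G v‖ ^ 2) ^ s)) := by
  obtain ⟨κ, hκ⟩ := exists_convForm_riesz_le hd hγ hq hs hs₀ hs₁
  obtain ⟨c, hc⟩ : ∃ c, c = ((d : ℝ) - 1) * (γ + d) := ⟨_, rfl⟩
  refine ⟨‖c‖₊ * (Real.toNNReal (2 ^ (-γ)) * (1 + κ)), fun φ g G hu hg hgq => ?_⟩
  rw [abs_of_nonpos hγ₀] at hgq ⊢
  have hN : ∫⁻ w, ‖g w‖ₑ = ENNReal.ofReal (∫ w, |g w|) :=
    (ofReal_integral_norm_eq_lintegral_enorm hg).symm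
  have hweight : AEMeasurable (fun w => ENNReal.ofReal (bracket w ^ (-γ)) * ‖g w‖ₑ) volume :=
    (measurable_bracket.pow_const _).ennreal_ofReal.aemeasurable.mul hg.1.enorm
  rw [← lintegral_enorm_sq_bracket_rpow_mul hu.1, ← lintegral_enorm_sq_eq hu.2.1,
    ← eLpNorm'_bracket_rpow_mul_enorm (by linarith) hgq, ← hN]
  calc ∫⁻ v, ‖φ v ^ 2 * cCoeff γ g v‖ₑ
      ≤ ‖c‖ₑ * convForm (fun v => ‖φ v‖ₑ ^ 2) (fun z => ENNReal.ofReal (‖z‖ ^ γ))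
          (fun w => ‖g w‖ₑ) volume := hc ▸ lintegral_sq_mul_cCoeff_le_convForm hγ.ne' φ g
    _ ≤ ‖c‖ₑ * (ENNReal.ofReal (2 ^ (-γ)) * (_ + κ * _)) :=
        mul_le_mul_right ((convForm_sq_le_weighted hγ₀ hu.1.1 hg.1).trans
          (mul_le_mul_right (add_le_add le_rfl (hκ _ G _ hu hweight)) _)) _
    _ ≤ _ := by
        rw [ENNReal.coe_mul, ENNReal.coe_mul, mul_assoc, mul_assoc, ENNReal.coe_add,
          ENNReal.coe_one, mul_add (1 + (κ : ℝ≥0∞)), ENNReal.ofReal, enorm_eq_nnnorm]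
        gcongr _ * (_ * (?_ + ?_ * _))
        · exact le_mul_of_one_le_left' le_self_add
        · exact le_add_self

theorem exists_lintegral_sq_mul_cCoeff_neg_dim_le (hd : 3 ≤ d) (hq : (d : ℝ) / 2 < q)
    (hs : s = d / (2 * q)) :
    ∃ C : ℝ≥0, ∀ (φ g : EuclideanSpace ℝ (Fin d) → ℝ)
      (G : EuclideanSpace ℝ (Fin d) → EuclideanSpace ℝ (Fin d)),
      IsH1WithGradient (fun v => bracket v ^ (-(d : ℝ) / 2) * φ v) G →
      MemWeightedLp q (q * d) g →
      ∫⁻ v, ‖φ v ^ 2 * cCoeff (-(d : ℝ)) g v‖ₑ ≤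
        C * (ENNReal.ofReal (weightedLpNorm q (q * d) g) *
          (ENNReal.ofReal (∫ v, φ v ^ 2 * bracket v ^ (-(d : ℝ))) ^ (1 - s) *
            ENNReal.ofReal (∫ v, ‖G v‖ ^ 2) ^ s)) := by
  refine ⟨‖((d : ℝ) - 1) * ((d : ℝ) - 2) * sphereArea d‖₊ * sobolevConst d ^ s,
    fun φ g G hu hgq => ?_⟩
  have hq₀ : 0 < q := lt_of_le_of_lt (by positivity) hq
  have hweight : AEMeasurable (fun w => ENNReal.ofReal (bracket w ^ (d : ℝ)) * ‖g w‖ₑ) volume :=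
    (measurable_bracket.pow_const _).ennreal_ofReal.aemeasurable.mul hgq.1.enorm
  rw [← lintegral_enorm_sq_bracket_rpow_mul hu.1, ← lintegral_enorm_sq_eq hu.2.1,
    ← eLpNorm'_bracket_rpow_mul_enorm hq₀ hgq, lintegral_sq_mul_cCoeff_neg_dim, ENNReal.coe_mul]
  exact (mul_le_mul_right (hu.lintegral_sq_mul_le hd hweight hq hs) _).trans_eq
    (mul_assoc _ _ _).symm

theorem riesz_exponent_mem_Ioo (hγ : 0 < d + γ) (hq : 0 < q)
    (hq_lower : (d : ℝ) / (d + 2 + γ) < q) (hq_upper : q < (d : ℝ) / (d + γ))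
    (hs : s = ((d : ℝ) - q * (d + γ)) / (2 * q)) : 0 < s ∧ s < 1 := by
  rw [div_lt_iff₀ (by linarith)] at hq_lower
  rw [lt_div_iff₀ hγ] at hq_upper
  rw [hs, div_lt_one (by linarith)]
  exact ⟨div_pos (by linarith) (by linarith), by linarith⟩

theorem coulomb_exponent_mem_Ico (hq : (d : ℝ) / 2 < q) (hs : s = d / (2 * q)) :
    0 ≤ s ∧ s < 1 := by
  have hq₀ : 0 < q := lt_of_le_of_lt (by positivity) hq
  rw [hs, div_lt_one (by linarith)]
  exact ⟨by positivity, by linarith⟩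

theorem coulomb_exponent_ratios (hq : 0 < q) (hs : s = d / (2 * q)) :
    s / (1 - s) = d / (2 * q - d) ∧ 1 / (1 - s) = 2 * q / (2 * q - d) := by
  rw [hs, one_sub_div (by positivity)]
  constructor <;> field_simp

end Estimates

end Landau

end

theorem proposition3p4_general (d : ℕ) (hd : 3 ≤ d) :
    (∀ γ q s : ℝ, -(d : ℝ) < γ → γ < 0 → 1 ≤ q →
      (d : ℝ) / (d + 2 + γ) < q → q < (d : ℝ) / (d + γ) →
      s = ((d : ℝ) - q * (d + γ)) / (2 * q) →
      (0 < s ∧ s < 1) ∧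
      ∃ C₀ : ℝ, 0 < C₀ ∧
        ∀ (φ g : EuclideanSpace ℝ (Fin d) → ℝ)
          (G : EuclideanSpace ℝ (Fin d) → EuclideanSpace ℝ (Fin d)),
          Landau.IsH1WithGradient (fun v => Landau.bracket v ^ (γ / 2) * φ v) G →
          Integrable g → Landau.MemWeightedLp q (q * |γ|) g →
          (∀ᵐ v : EuclideanSpace ℝ (Fin d), Integrable (fun w => ‖v - w‖ ^ γ * g w)) ∧
          Integrable (fun v => φ v ^ 2 * Landau.cCoeff γ g v) ∧
          ∀ ε : ℝ, 0 < ε →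
            ∫ v, |φ v ^ 2 * Landau.cCoeff γ g v| ≤
              ε * (∫ v, ‖G v‖ ^ 2) +
                C₀ * ((∫ v, |g v|) +
                    ε ^ (-(s / (1 - s))) *
                      Landau.weightedLpNorm q (q * |γ|) g ^ (1 / (1 - s))) *
                  ∫ v, φ v ^ 2 * Landau.bracket v ^ γ) ∧
    (∀ q : ℝ, (d : ℝ) / 2 < q →
      ∃ C₀ : ℝ, 0 < C₀ ∧
        ∀ (φ g : EuclideanSpace ℝ (Fin d) → ℝ)
          (G : EuclideanSpace ℝ (Fin d) → EuclideanSpace ℝ (Fin d)),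
          Landau.IsH1WithGradient (fun v => Landau.bracket v ^ (-(d : ℝ) / 2) * φ v) G →
          Landau.MemWeightedLp q (q * d) g →
          Integrable (fun v => φ v ^ 2 * Landau.cCoeff (-(d : ℝ)) g v) ∧
          ∀ ε : ℝ, 0 < ε →
            ∫ v, |φ v ^ 2 * Landau.cCoeff (-(d : ℝ)) g v| ≤
              ε * (∫ v, ‖G v‖ ^ 2) +
                C₀ * ε ^ (-((d : ℝ) / (2 * q - d))) *
                  Landau.weightedLpNorm q (q * d) g ^ (2 * q / (2 * q - d)) *
                  ∫ v, φ v ^ 2 * Landau.bracket v ^ (-(d : ℝ))) := by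
  have hd' : (3 : ℝ) ≤ d := by exact_mod_cast hd
  refine ⟨fun γ q s hγ hγ₀ hq hq_lower hq_upper hs => ?_, fun q hq => ?_⟩
  · have hq₀ : 0 < q := by linarith
    obtain ⟨hs₀, hs₁⟩ :=
      Landau.riesz_exponent_mem_Ioo (by linarith) hq₀ hq_lower hq_upper hs
    have hγ_eq : γ = d / q - d - 2 * s := by
      rw [hs]
      field_simp
      ring
    obtain ⟨C, hC⟩ :=
      Landau.exists_lintegral_sq_mul_cCoeff_le hd hγ hγ₀.le hq hγ_eq hs₀ hs₁
    refine ⟨⟨hs₀, hs₁⟩, (1 + (C : ℝ)) ^ (1 / (1 - s)), by positivity,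
      fun φ g G hu hg hgq => ⟨?_, ?_⟩⟩
    · have := Landau.nontrivial_euclideanSpace (d := d) (by lia)
      refine Landau.ae_integrable_norm_sub_rpow_mul ?_ hγ₀.le hg
      rw [finrank_euclideanSpace_fin]
      linarith
    · exact Landau.integrable_and_integral_abs_le
        (Landau.aestronglyMeasurable_sq_mul_cCoeff hu.1.1 hg.1)
        (integral_nonneg fun _ => abs_nonneg _) (Landau.weightedLpNorm_nonneg _ _ _)
        (Landau.integral_sq_mul_bracket_rpow_nonneg φ γ) (integral_nonneg fun _ => by positivity)
        hs₀.le hs₁ (hC φ g G hu hg hgq)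
  · obtain ⟨s, hs⟩ : ∃ s, s = d / (2 * q) := ⟨_, rfl⟩
    obtain ⟨hs₀, hs₁⟩ := Landau.coulomb_exponent_mem_Ico hq hs
    obtain ⟨hs_ratio, hs_inv⟩ := Landau.coulomb_exponent_ratios (by linarith) hs
    obtain ⟨C, hC⟩ := Landau.exists_lintegral_sq_mul_cCoeff_neg_dim_le hd hq hs
    refine ⟨(1 + (C : ℝ)) ^ (1 / (1 - s)), by positivity, fun φ g G hu hgq => ?_⟩
    rw [← hs_ratio, ← hs_inv]
    simpa only [zero_add, mul_assoc] using Landau.integrable_and_integral_abs_le (N := 0)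
      (Landau.aestronglyMeasurable_sq_mul_cCoeff hu.1.1 hgq.1) le_rfl
      (Landau.weightedLpNorm_nonneg _ _ _)
      (Landau.integral_sq_mul_bracket_rpow_nonneg φ (-(d : ℝ)))
      (integral_nonneg fun _ => by positivity) hs₀ hs₁ (by simpa using hC φ g G hu hgq)

theorem proposition3p4 (d : ℕ) (hd : 3 ≤ d) :
    (∀ γ q s : ℝ, -(d : ℝ) < γ → γ < 0 → 1 ≤ q →
      (d : ℝ) / (d + 2 + γ) < q → q < (d : ℝ) / (d + γ) →
      s = ((d : ℝ) - q * (d + γ)) / (2 * q) →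
      (0 < s ∧ s < 1) ∧
      ∃ C₀ : ℝ, 0 < C₀ ∧
        ∀ (φ g : EuclideanSpace ℝ (Fin d) → ℝ)
          (G : EuclideanSpace ℝ (Fin d) → EuclideanSpace ℝ (Fin d)),
          Landau.IsH1WithGradient (fun v => Landau.bracket v ^ (γ / 2) * φ v) G →
          (∀ᵐ v, 0 ≤ g v) → Integrable g → Landau.MemWeightedLp q (q * |γ|) g →
          (∀ᵐ v : EuclideanSpace ℝ (Fin d), Integrable (fun w => ‖v - w‖ ^ γ * g w)) ∧
          Integrable (fun v => φ v ^ 2 * Landau.cCoeff γ g v) ∧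
          ∀ ε : ℝ, 0 < ε →
            -∫ v, φ v ^ 2 * Landau.cCoeff γ g v ≤
              ε * (∫ v, ‖G v‖ ^ 2) +
                C₀ * ((∫ v, |g v|) +
                    ε ^ (-(s / (1 - s))) *
                      Landau.weightedLpNorm q (q * |γ|) g ^ (1 / (1 - s))) *
                  ∫ v, φ v ^ 2 * Landau.bracket v ^ γ) ∧
    (∀ q : ℝ, (d : ℝ) / 2 < q →
      ∃ C₀ : ℝ, 0 < C₀ ∧
        ∀ (φ g : EuclideanSpace ℝ (Fin d) → ℝ)
          (G : EuclideanSpace ℝ (Fin d) → EuclideanSpace ℝ (Fin d)),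
          Landau.IsH1WithGradient (fun v => Landau.bracket v ^ (-(d : ℝ) / 2) * φ v) G →
          (∀ᵐ v, 0 ≤ g v) → Landau.MemWeightedLp q (q * d) g →
          Integrable (fun v => φ v ^ 2 * Landau.cCoeff (-(d : ℝ)) g v) ∧
          ∀ ε : ℝ, 0 < ε →
            -∫ v, φ v ^ 2 * Landau.cCoeff (-(d : ℝ)) g v ≤
              ε * (∫ v, ‖G v‖ ^ 2) +
                C₀ * ε ^ (-((d : ℝ) / (2 * q - d))) *
                  Landau.weightedLpNorm q (q * d) g ^ (2 * q / (2 * q - d)) *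
                  ∫ v, φ v ^ 2 * Landau.bracket v ^ (-(d : ℝ))) := by
  obtain ⟨riesz, coulomb⟩ := proposition3p4_general d hd
  refine ⟨fun γ q s hγ hγ₀ hq hq_lower hq_upper hs => ?_, fun q hq => ?_⟩
  · obtain ⟨hs₀₁, C₀, hC₀, h⟩ := riesz γ q s hγ hγ₀ hq hq_lower hq_upper hs
    refine ⟨hs₀₁, C₀, hC₀, fun φ g G hu _ hg hgq => ?_⟩
    obtain ⟨hconv, hint, hle⟩ := h φ g G hu hg hgq
    exact ⟨hconv, hint, fun ε hε =>
      ((neg_le_abs _).trans abs_integral_le_integral_abs).trans (hle ε hε)⟩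
  · obtain ⟨C₀, hC₀, h⟩ := coulomb q hq
    refine ⟨C₀, hC₀, fun φ g G hu _ hgq => (h φ g G hu hgq).imp_right fun hle ε hε => ?_⟩
    exact ((neg_le_abs _).trans abs_integral_le_integral_abs).trans (hle ε hε)
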